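/- Let $\mathbb C'=\{x+i'y : x,y\in\mathbb R\}$, $(i')^2=1$, be the para-complex numbers, $\overline{x+i'y}=x-i'y$, $\partial_z=\frac12(\partial_x+i'\partial_y)$, $\partial_{\bar z}=\frac12(\partial_x-i'\partial_y)$. If $w=x+i'y$ is a square in $\mathbb C'$ (that is, $x\pm y\ge 0$), let $\sqrt w$ be its principal root $\frac12(\sqrt{x+y}+\sqrt{x-y})+\frac{i'}2(\sqrt{x+y}-\sqrt{x-y})$. Let $\mathrm{Nil}_t^3$ be $\mathbb R^3$ with the product $(x_1,x_2,x_3)\cdot(y_1,y_2,y_3)=(x_1+y_1,\,x_2+y_2,\,x_3+y_3+\frac12(x_1y_2-y_1x_2))$ and the left-invariant metric $-dx_1^2+dx_2^2+(dx_3+\frac12(x_2dx_1-x_1dx_2))^2$, and let $\varepsilon_1,\varepsilon_2,\varepsilon_3$ be the orthonormal basis of its Lie algebra given by the coordinate vectors at the origin. For $\kappa\in\{\pm1,\pm i'\}$, functions $\psi_1,\psi_2$ are generating spinors, with sign $\sigma\in\{i',-i'\}$, of a map $f$ with respect to the coordinate $\kappa z$ if $f^{-1}f_{\kappa z}=\varphi_1\varepsilon_1+\varphi_2\varepsilon_2+\varphi_3\varepsilon_3$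 with $\varphi_1=\sigma(\overline{\psi_2}^2+\psi_1^2)$, $\varphi_2=\sigma i'(\overline{\psi_2}^2-\psi_1^2)$, $\varphi_3=2\psi_1\overline{\psi_2}$, where $f_{\kappa z}=\kappa f_z$. For a minimal surface the coefficient of the Abresch–Rosenberg differential $4B\,dz^2$ is $B=\frac14\left(-i'A-\varphi_3^2\right)$ with $A=2\left(\psi_1\partial\overline{\psi_2}-\overline{\psi_2}\,\partial\psi_1\right)-4i'(\psi_1\overline{\psi_2})^2$ and $\partial=\partial_{\kappa z}=\kappa\partial_z$. A Dirac potential is a function $U=V$ with $\partial_{\kappa z}\psi_2+U\psi_1=0$ and $-\overline\kappa\,\partial_{\bar z}\psi_1+V\psi_2=0$. For a unit normal field $N$ and conformal factor $e^u$ the support function is $\langle f^{-1}e^{u/2}N,\varepsilon_3\rangle$, and the normal Gauss map is the stereographic projection of $f^{-1}N$ from $\varepsilon_3$ to $\mathbb C'$. Let $D\subset\mathbb C'$ be open and simply connected, and let $f:D\to\mathrm{Nil}_t^3$ be a smooth conformal timelike immersion with metric $e^u\,dz\,d\bar z$, with mean curvature $0$, unit normal $N$, and smooth generating spinors $\psi_1,\psi_2$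 with respect to $z$ with sign $\sigma$. Assume that $h=2(\psi_2\overline{\psi_2}-\psi_1\overline{\psi_1})>0$ on $D$; $N$ is either choice of unit normal, and $\langle f^{-1}e^{u/2}N,\varepsilon_3\rangle=s\,h$ with $s\in\{1,-1\}$ constant. Assume that $f$ is not a null scroll, $B\overline B\not\equiv0$, put $R=\{z\in D: B\overline B\ne0\}$, and let $\epsilon:D\to\{\pm1,\pm i'\}$ be such that $\epsilon B$ is a square in $\mathbb C'$ at every point (on $R$, such $\epsilon$ is unique and locally constant). Define $$\psi_1^*=\frac{4\sqrt{\epsilon B}}{h}\,\psi_2,\qquad \psi_2^*=\frac{4\sqrt{\bar\epsilon\bar B}}{h}\,\psi_1 .$$ Then there is a smooth map $f^*:D\to\mathrm{Nil}_t^3$ generated by $\psi_1^*,\psi_2^*$ with respect to the coordinate $z^*=\epsilon z$, with sign $-\sigma$. The dual spinors are smooth on $R$ and every such $f^*$ has the following properties on $R$. (0) With $e^{w^*/2}=4\sqrt{\epsilon\bar\epsilon B\bar B}/h$, the pair $(\psi_1^*,\psi_2^*)$ has Dirac potential $U^*=V^*=-i'e^{w^*/2}$ with respect to $z^*$. The pair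 $(i'\psi_1^*,-i'\psi_2^*)$, which generates the same $f^*$, has Dirac potential $i'e^{w^*/2}$ and satisfies $2(\psi_2\overline{\psi_2}-\psi_1\overline{\psi_1})=16\sqrt{\epsilon\bar\epsilon B\bar B}/h$ with $\psi_1,\psi_2$ replaced by its members. Every unit normal $N'$ of $f^*$ satisfies $(f^*)^{-1}N'=\pm f^{-1}N$. (1) $f^*$ is a conformal immersion with respect to $z^*$, with metric $e^{u^*}dz^*d\overline{z^*}=\epsilon\bar\epsilon\,e^{u^*}dz\,d\bar z$. With the unit normal $N^*$ for which $(f^*)^{-1}N^*=f^{-1}N$, $$e^{u^*/2}=\frac{16\sqrt{\epsilon\bar\epsilon B\bar B}}{h^2}\,e^{u/2},\qquad h^*=\frac{16\sqrt{\epsilon\bar\epsilon B\bar B}}{h},\qquad B^*=B,\qquad g^*=g,$$ where $\langle (f^*)^{-1}e^{u^*/2}N^*,\varepsilon_3\rangle=s\,h^*$, $B^*$ is the Abresch–Rosenberg coefficient of $f^*$ computed from $\psi_1^*,\psi_2^*$ in the coordinate $z^*$ (note $(dz^*)^2=dz^2$), and $g,g^*$ are the normal Gauss maps. (2) $f^*$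 is timelike and has mean curvature $0$, and it is non-vertical (its left-translated tangent planes do not contain $\varepsilon_3$). (3) The double-dual spinors $\psi_1^{**}=4\sqrt{\epsilon B^*}\,\psi_2^*/h^*$ and $\psi_2^{**}=4\sqrt{\bar\epsilon\overline{B^*}}\,\psi_1^*/h^*$ equal $\psi_1$ and $\psi_2$ on $R$. Hence $f$ is a dual surface of $f^*$ on $R$, and on every connected open subset of $R$ every dual surface $f^{**}$ of $f^*$ is a left translate of $f$; that is, $f^{**}=f$ up to a rigid motion. -/

import Mathlib

open Set
open scoped ContDiff

noncomputable section

namespace NilT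

/-! ### Para-complex numbers -/

/-- Para-complex numbers `x + i' y` with `i' ^ 2 = 1`; `star` is para-conjugation. -/
abbrev PC : Type := QuadraticAlgebra ℝ 1 0

/-- The para-complex imaginary unit. -/
def ip : PC := ⟨0, 1⟩

lemma ip_mul_ip : ip * ip = 1 := by
  rw [QuadraticAlgebra.ext_iff]
  simp [ip, QuadraticAlgebra.re_one, QuadraticAlgebra.im_one]

/-- The four units `1, -1, i', -i'`. -/
def IsSignUnit (e : PC) : Prop := e = 1 ∨ e = -1 ∨ e = ip ∨ e = -ip

/-- Principal para-complex square root: in the components `x + y` and `x - y` it is the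
nonnegative real square root. -/
def psqrt (w : PC) : PC :=
  ⟨(Real.sqrt (w.re + w.im) + Real.sqrt (w.re - w.im)) / 2,
   (Real.sqrt (w.re + w.im) - Real.sqrt (w.re - w.im)) / 2⟩

lemma psqrt_mul_self {w : PC} (hw : IsSquare w) : psqrt w * psqrt w = w := by
  obtain ⟨r, rfl⟩ := hw
  have h1 : (r * r).re + (r * r).im = (r.re + r.im) ^ 2 := by simp; ring
  have h2 : (r * r).re - (r * r).im = (r.re - r.im) ^ 2 := by simp; ring
  have a1 := sq_abs (r.re + r.im)
  have a2 := sq_abs (r.re - r.im)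
  have e : psqrt (r * r) = ⟨(|r.re + r.im| + |r.re - r.im|) / 2,
      (|r.re + r.im| - |r.re - r.im|) / 2⟩ := by
    simp only [psqrt, h1, h2, Real.sqrt_sq_eq_abs]
  rw [e]
  ext
  · simp only [QuadraticAlgebra.re_mul]
    linarith
  · simp only [QuadraticAlgebra.im_mul]
    linarith

/-- Smoothness of a para-complex valued function of `z = x + i' y`, written as `(x, y)`. -/
def SmoothOn (F : ℝ × ℝ → PC) (W : Set (ℝ × ℝ)) : Prop :=
  ContDiffOn ℝ ∞ (fun z => (F z).re) W ∧ ContDiffOn ℝ ∞ (fun z => (F z).im) W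

/-- `∂F/∂x`. -/
def pdx (F : ℝ × ℝ → PC) (z : ℝ × ℝ) : PC :=
  ⟨fderiv ℝ (fun p => (F p).re) z (1, 0), fderiv ℝ (fun p => (F p).im) z (1, 0)⟩

/-- `∂F/∂y`. -/
def pdy (F : ℝ × ℝ → PC) (z : ℝ × ℝ) : PC :=
  ⟨fderiv ℝ (fun p => (F p).re) z (0, 1), fderiv ℝ (fun p => (F p).im) z (0, 1)⟩

/-- `∂F/∂z = (∂F/∂x + i' ∂F/∂y) / 2`. -/
def dz (F : ℝ × ℝ → PC) (z : ℝ × ℝ) : PC := (1 / 2 : ℝ) • (pdx F z + ip * pdy F z)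

/-- `∂F/∂z̄ = (∂F/∂x - i' ∂F/∂y) / 2`. -/
def dzbar (F : ℝ × ℝ → PC) (z : ℝ × ℝ) : PC := (1 / 2 : ℝ) • (pdx F z - ip * pdy F z)

/-! ### The Lorentzian Heisenberg group `Nil_t^3` -/

abbrev Vec3 : Type := Fin 3 → ℝ

/-- The Heisenberg group law on `ℝ³`. -/
def nilMul (p q : Vec3) : Vec3 :=
  ![p 0 + q 0, p 1 + q 1, p 2 + q 2 + (1 / 2) * (p 0 * q 1 - q 0 * p 1)]

/-- Left translation of the tangent vector `v` at `p` to the identity, in the basis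
`ε₁, ε₂, ε₃` of the Lie algebra. -/
def leftPull (p v : Vec3) : Vec3 :=
  ![v 0, v 1, v 2 + (1 / 2) * (p 1 * v 0 - p 0 * v 1)]

/-- The scalar product on the Lie algebra; `lip (leftPull p v) (leftPull p v)` is the metric
`-dx₁² + dx₂² + (dx₃ + (x₂ dx₁ - x₁ dx₂)/2)²` of `Nil_t^3`. -/
def lip (X Y : Vec3) : ℝ := -(X 0 * Y 0) + X 1 * Y 1 + X 2 * Y 2

/-- The Lie bracket: `[ε₁, ε₂] = ε₃`, and `ε₃` is central. -/
def bracket (X Y : Vec3) : Vec3 := ![0, 0, X 0 * Y 1 - X 1 * Y 0]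

/-- The Levi-Civita connection of `Nil_t^3` on left-invariant fields. -/
def conn (X Y : Vec3) : Vec3 :=
  ![-(1 / 2) * (X 1 * Y 2 + X 2 * Y 1), -(1 / 2) * (X 0 * Y 2 + X 2 * Y 0),
    (1 / 2) * (X 0 * Y 1 - X 1 * Y 0)]

lemma conn_torsionFree (X Y : Vec3) : conn X Y - conn Y X = bracket X Y := by
  ext i
  fin_cases i <;> simp [conn, bracket] <;> ring

lemma conn_metric (X Y Z : Vec3) : lip (conn X Y) Z + lip Y (conn X Z) = 0 := by
  simp [conn, lip]
  ring

/-! ### Surfaces in `Nil_t^3` -/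

/-- `f⁻¹ f_x`. -/
def mcX (f : ℝ × ℝ → Vec3) (z : ℝ × ℝ) : Vec3 := leftPull (f z) (fderiv ℝ f z (1, 0))

/-- `f⁻¹ f_y`. -/
def mcY (f : ℝ × ℝ → Vec3) (z : ℝ × ℝ) : Vec3 := leftPull (f z) (fderiv ℝ f z (0, 1))

/-- `φ_k`, the components of `f⁻¹ f_z = φ₁ ε₁ + φ₂ ε₂ + φ₃ ε₃` (`k = 0, 1, 2`). -/
def phi (f : ℝ × ℝ → Vec3) (k : Fin 3) (z : ℝ × ℝ) : PC := ⟨mcX f z k / 2, mcY f z k / 2⟩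

/-- Coefficients of the induced metric `E dx² + 2 F dx dy + G dy²`. -/
def formE (f : ℝ × ℝ → Vec3) (z : ℝ × ℝ) : ℝ := lip (mcX f z) (mcX f z)
def formF (f : ℝ × ℝ → Vec3) (z : ℝ × ℝ) : ℝ := lip (mcX f z) (mcY f z)
def formG (f : ℝ × ℝ → Vec3) (z : ℝ × ℝ) : ℝ := lip (mcY f z) (mcY f z)

/-- `f` is on `W` a smooth timelike immersion, conformal with respect to the para-complex
coordinate `κ z` (`κ` is locally constant with values in `{1, -1, i', -i'}`), with metric
`e^u d(κz) d(κz)‾ = κ κ̄ e^u (dx² - dy²)`. -/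
structure IsConformalTimelikeOn (W : Set (ℝ × ℝ)) (κ : ℝ × ℝ → PC) (f : ℝ × ℝ → Vec3)
    (u : ℝ × ℝ → ℝ) : Prop where
  smooth : ContDiffOn ℝ ∞ f W
  immersion : ∀ z ∈ W, Function.Injective (fderiv ℝ f z)
  metricE : ∀ z ∈ W, formE f z = (κ z * star (κ z)).re * Real.exp (u z)
  metricF : ∀ z ∈ W, formF f z = 0
  metricG : ∀ z ∈ W, formG f z = -((κ z * star (κ z)).re * Real.exp (u z))

/-- `f⁻¹ N` for a vector field `N` along `f`. -/
def leftNormal (f N : ℝ × ℝ → Vec3) (z : ℝ × ℝ) : Vec3 := leftPull (f z) (N z)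

/-- `N` is a unit normal field along `f` over `W`. -/
def IsUnitNormalOn (W : Set (ℝ × ℝ)) (f N : ℝ × ℝ → Vec3) : Prop :=
  ∀ z ∈ W, lip (leftNormal f N z) (leftNormal f N z) = 1 ∧
    lip (leftNormal f N z) (mcX f z) = 0 ∧ lip (leftNormal f N z) (mcY f z) = 0

/-- Coefficients of the second fundamental form with respect to the unit normal `N`, from the
covariant derivatives of `f_x` and `f_y` along `f`. -/
def secL (f N : ℝ × ℝ → Vec3) (z : ℝ × ℝ) : ℝ :=
  lip (fderiv ℝ (mcX f) z (1, 0) + conn (mcX f z) (mcX f z)) (leftNormal f N z)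
def secM (f N : ℝ × ℝ → Vec3) (z : ℝ × ℝ) : ℝ :=
  lip (fderiv ℝ (mcY f) z (1, 0) + conn (mcX f z) (mcY f z)) (leftNormal f N z)
def secN (f N : ℝ × ℝ → Vec3) (z : ℝ × ℝ) : ℝ :=
  lip (fderiv ℝ (mcY f) z (0, 1) + conn (mcY f z) (mcY f z)) (leftNormal f N z)

/-- The mean curvature: half the trace of the second fundamental form with respect to the
induced metric. -/
def meanCurvature (f N : ℝ × ℝ → Vec3) (z : ℝ × ℝ) : ℝ :=
  (formE f z * secN f N z - 2 * formF f z * secM f N z + formG f z * secL f N z) /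
    (2 * (formE f z * formG f z - formF f z ^ 2))

/-- The support function `⟨f⁻¹ L, ε₃⟩` with `L = e^{u/2} N`. -/
def supportFn (u : ℝ × ℝ → ℝ) (f N : ℝ × ℝ → Vec3) (z : ℝ × ℝ) : ℝ :=
  lip (Real.exp (u z / 2) • leftNormal f N z) ![0, 0, 1]

/-- The normal Gauss map: stereographic projection of `f⁻¹ N` from `(0, 0, 1)`. -/
def gaussMap (f N : ℝ × ℝ → Vec3) (z : ℝ × ℝ) : PC :=
  (1 - leftNormal f N z 2)⁻¹ • (⟨leftNormal f N z 0, leftNormal f N z 1⟩ : PC)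

/-- The tangent plane of `f` at `z` does not contain the direction of `ε₃`. -/
def IsNonverticalAt (f : ℝ × ℝ → Vec3) (z : ℝ × ℝ) : Prop :=
  (![0, 0, 1] : Vec3) ∉ Submodule.span ℝ ({mcX f z, mcY f z} : Set Vec3)

/-! ### Generating spinors -/

/-- `ψ₁, ψ₂` are generating spinors of `f` with respect to the coordinate `κ z`, with sign `σ`
(which is `i'` or `-i'`). Since `κ² = 1`, one has `∂_z = κ ∂_{κz}`, hence the factor `κ`. -/
def IsGeneratedOn (W : Set (ℝ × ℝ)) (κ : ℝ × ℝ → PC) (σ : PC) (ψ₁ ψ₂ : ℝ × ℝ → PC)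
    (f : ℝ × ℝ → Vec3) : Prop :=
  ∀ z ∈ W,
    phi f 0 z = κ z * (σ * (star (ψ₂ z) ^ 2 + ψ₁ z ^ 2)) ∧
    phi f 1 z = κ z * (σ * ip * (star (ψ₂ z) ^ 2 - ψ₁ z ^ 2)) ∧
    phi f 2 z = κ z * (2 * (ψ₁ z * star (ψ₂ z)))

/-- The support function in terms of spinors, `2 (ψ₂ ψ̄₂ - ψ₁ ψ̄₁)`. -/
def spinorSupport (ψ₁ ψ₂ : ℝ × ℝ → PC) (z : ℝ × ℝ) : ℝ :=
  2 * (ψ₂ z * star (ψ₂ z) - ψ₁ z * star (ψ₁ z)).re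

/-- The nonlinear Dirac equations `∂ψ₂ + U ψ₁ = 0`, `-∂̄ψ₁ + V ψ₂ = 0` with Dirac potential
`U = V`, where `∂ = κ ∂_z` and `∂̄ = κ̄ ∂_z̄` belong to the coordinate `κ z`. -/
def IsDiracPotentialOn (W : Set (ℝ × ℝ)) (κ U ψ₁ ψ₂ : ℝ × ℝ → PC) : Prop :=
  ∀ z ∈ W, κ z * dz ψ₂ z + U z * ψ₁ z = 0 ∧ -(star (κ z) * dzbar ψ₁ z) + U z * ψ₂ z = 0

/-- The Hopf differential coefficient
`2 (ψ₁ ∂(ψ̄₂) - ψ̄₂ ∂ψ₁) - 4 i' (ψ₁ ψ̄₂)²` in the coordinate `κ z`. -/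
def hopf (κ ψ₁ ψ₂ : ℝ × ℝ → PC) (z : ℝ × ℝ) : PC :=
  2 * (ψ₁ z * (κ z * dz (fun p => star (ψ₂ p)) z) - star (ψ₂ z) * (κ z * dz ψ₁ z))
    - 4 * ip * (ψ₁ z * star (ψ₂ z)) ^ 2

/-- The coefficient `B` of the Abresch-Rosenberg differential `4 B dz²` for constant mean
curvature `H`: `B = (2H - i')/4 · (A - φ₃² / (2H - i'))` with the Hopf coefficient `A` and
`φ₃ = 2 ψ₁ ψ̄₂`, written without the division. -/
def arCoeff (H : ℝ) (κ ψ₁ ψ₂ : ℝ × ℝ → PC) (z : ℝ × ℝ) : PC :=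
  (1 / 4 : ℝ) • ((⟨2 * H, -1⟩ : PC) * hopf κ ψ₁ ψ₂ z - (2 * (ψ₁ z * star (ψ₂ z))) ^ 2)

/-! ### Dual surfaces -/

/-- `ψ₁* = 4 √(ε B) / h · ψ₂`. -/
def dualSpinor₁ (ε B : ℝ × ℝ → PC) (h : ℝ × ℝ → ℝ) (ψ₂ : ℝ × ℝ → PC) (z : ℝ × ℝ) : PC :=
  (4 / h z) • (psqrt (ε z * B z) * ψ₂ z)

/-- `ψ₂* = 4 √(ε̄ B̄) / h · ψ₁`. -/
def dualSpinor₂ (ε B : ℝ × ℝ → PC) (h : ℝ × ℝ → ℝ) (ψ₁ : ℝ × ℝ → PC) (z : ℝ × ℝ) : PC :=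
  (4 / h z) • (psqrt (star (ε z) * star (B z)) * ψ₁ z)

/-- The real number `√(ε ε̄ B B̄)`. -/
def rootBB (ε B : ℝ × ℝ → PC) (z : ℝ × ℝ) : ℝ :=
  Real.sqrt (ε z * star (ε z) * B z * star (B z)).re

/-- `g` is on `W` a dual surface of the surface with generating spinors `ψ₁, ψ₂` (coordinate `κ z`,
sign `σ`), Abresch-Rosenberg coefficient `B` and support function `h`: a smooth map generated by the
dual spinors with respect to the coordinate `ε κ z`, with sign `-σ`. -/
def IsDualSurfaceOn (W : Set (ℝ × ℝ)) (κ ε : ℝ × ℝ → PC) (σ : PC) (ψ₁ ψ₂ B : ℝ × ℝ → PC)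
    (h : ℝ × ℝ → ℝ) (g : ℝ × ℝ → Vec3) : Prop :=
  ContDiffOn ℝ ∞ g W ∧
    IsGeneratedOn W (fun z => ε z * κ z) (-σ) (dualSpinor₁ ε B h ψ₂) (dualSpinor₂ ε B h ψ₁) g

end NilT

end

/-! Write a = ψ₁ and b = ψ̄₂, so that φ = f⁻¹f_z is quadratic in (a, b) and h = 2(b b̄ - a ā). A
conformal minimal immersion is harmonic, and vanishing tension together with the Maurer-Cartan
equation is one para-complex system for ∂̄φ, called `HarmonicEq`. Its real parts express vanishing
tension, its imaginary parts integrability (`harmonicEq_phi_iff`). As h is invertible, the system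
forces the Dirac equations 4∂̄a = i'h b̄, 4∂̄b = i'h ā (`diracEq_of_harmonicEq`).

For mean curvature 0 the quartic terms in the Abresch-Rosenberg coefficient cancel and 2B = -i'(a∂b
- b∂a). The Dirac equations then give ∂̄B = 0 (`dzbar_wronskian`) and, by the quotient rule, ∂̄(ā/h)
= -4i' b B̄/h² and ∂̄(b̄/h) = -4i' a B̄/h² (`dzbar_inv_mul_star`).

In the one-form of the dual spinors the root enters only as ε√(εB)² = B, so that φ* = (16B/h²) φ̄
(`isGeneratedOn_iff`). This is smooth on all of D, also where B B̄ = 0, and the formulas above show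
that it solves `HarmonicEq` again (`harmonicEq_dualForm`). It therefore integrates to a map on the
simply connected D (`exists_map_of_harmonicEq`), and that map has zero tension.

The geometry follows from φ* = c φ̄ with c = 16B/h². Where c c̄ ≠ 0 the left-translated tangent
planes of the two surfaces agree, hence also their normals and Gauss maps, and the metric
coefficients are multiplied by c c̄. The Dirac potential and B* = B come from differentiating the
dual spinors, using that √(εB) is para-holomorphic. Dualizing twice multiplies each spinor by
16√(εε̄BB̄)/(h h*) = 1, and maps with equal φ on a connected set differ by a left translation
(`exists_eq_nilMul`). -/

noncomputable section

namespace NilT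

/-! ### Closed one-forms on simply connected domains -/

/-- The real numbers with the discrete topology. -/
def DiscreteReal : Type := ℝ

instance : AddCommGroup DiscreteReal := inferInstanceAs (AddCommGroup ℝ)

/-- A real number as an element of the discrete space. -/
def DiscreteReal.of (x : ℝ) : DiscreteReal := x

instance : TopologicalSpace DiscreteReal := ⊥

instance : DiscreteTopology DiscreteReal := ⟨rfl⟩

section Primitive

variable {E : Type*} [NormedAddCommGroup E] [NormedSpace ℝ E] {U : Set E}

lemma exists_const_of_hasFDerivAt {F G : E → ℝ} {η : E → E →L[ℝ] ℝ} {s : Set E} (hs : IsOpen s)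
    (hsp : IsPreconnected s) (hF : ∀ x ∈ s, HasFDerivAt F (η x) x)
    (hG : ∀ x ∈ s, HasFDerivAt G (η x) x) : ∃ c, ∀ x ∈ s, F x - G x = c := by
  refine hs.exists_is_const_of_fderiv_eq_zero (𝕜 := ℝ) hsp ?_ ?_
  · exact fun x hx => ((hF x hx).sub (hG x hx)).differentiableAt.differentiableWithinAt
  · intro x hx
    have := ((hF x hx).sub (hG x hx)).fderiv
    rw [sub_self] at this
    exact this

/-- The bundle with discrete fibre whose sections are the primitives of a closed one-form that has
the primitive `F i` on the ball of radius `r i` around `i`. -/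
def primitiveCore (r : U → ℝ) (hr : ∀ i, 0 < r i) (F : U → E → ℝ) (η : E → E →L[ℝ] ℝ)
    (hF : ∀ i : U, ∀ x ∈ Metric.ball (i : E) (r i), HasFDerivAt (F i) (η x) x) :
    FiberBundleCore U U DiscreteReal where
  baseSet i := Subtype.val ⁻¹' Metric.ball (i : E) (r i)
  isOpen_baseSet i := Metric.isOpen_ball.preimage continuous_subtype_val
  indexAt x := x
  mem_baseSet_at x := Metric.mem_ball_self (hr x)
  coordChange i j x v := v + DiscreteReal.of (F i x - F j x)
  coordChange_self i x _ v := by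
    rw [sub_self]
    exact add_zero v
  continuousOn_coordChange i j := by
    -- Two balls meet in a convex set, where two primitives differ by a constant. Hence the
    -- transition map does not depend on the base point.
    obtain ⟨c, hc⟩ := exists_const_of_hasFDerivAt
      (Metric.isOpen_ball.inter Metric.isOpen_ball)
      ((convex_ball (i : E) (r i)).inter (convex_ball (j : E) (r j))).isPreconnected
      (fun x hx => hF i x hx.1) (fun x hx => hF j x hx.2)
    have hcont : Continuous (fun p : U × DiscreteReal => p.2 + DiscreteReal.of c) :=
      (continuous_of_discreteTopology (f := fun v : DiscreteReal => v + DiscreteReal.of c)).comp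
        continuous_snd
    refine hcont.continuousOn.congr fun p hp => ?_
    exact congrArg (fun t => p.2 + DiscreteReal.of t) (hc p.1 hp.1)
  coordChange_comp i j k x _ v := by
    have h1 : DiscreteReal.of (F i x - F j x) + DiscreteReal.of (F j x - F k x)
        = DiscreteReal.of (F i x - F k x) := sub_add_sub_cancel (F i x) (F j x) (F k x)
    rw [add_assoc, h1]

/-- A closed one-form on a simply connected open set has a primitive. -/
theorem exists_primitive (hU : IsOpen U) (hsc : SimplyConnectedSpace U) {η : E → E →L[ℝ] ℝ}
    (hη : DifferentiableOn ℝ η U)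
    (hsymm : ∀ a ∈ U, ∀ x y, fderiv ℝ η a x y = fderiv ℝ η a y x) :
    ∃ G : E → ℝ, ∀ x ∈ U, HasFDerivAt G (η x) x := by
  classical
  have hloc : ∀ i : U, ∃ r > 0, Metric.ball (i : E) r ⊆ U ∧
      ∃ F : E → ℝ, ∀ x ∈ Metric.ball (i : E) r, HasFDerivAt F (η x) x := by
    intro i
    obtain ⟨r, hr, hrU⟩ := Metric.isOpen_iff.1 hU i i.2
    exact ⟨r, hr, hrU, (convex_ball (i : E) r).exists_forall_hasFDerivAt_of_fderiv_symmetric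
      Metric.isOpen_ball (hη.mono hrU) fun a ha => hsymm a (hrU ha)⟩
  choose r hr hrU F hF using hloc
  let Z := primitiveCore r hr F η hF
  -- With discrete fibre the bundle is a covering, so over a simply connected base the identity
  -- lifts to a global section. Such a section chooses local primitives that fit together.
  have hcov : IsCoveringMap Z.proj := IsFiberBundle.isCoveringMap fun x =>
    ⟨Z.localTriv x, Z.mem_baseSet_at x⟩
  have : LocallyPathConnectedSpace U := hU.locallyPathConnectedSpace
  have : Nonempty U := inferInstance
  let x₀ : U := Classical.arbitrary U
  obtain ⟨S, ⟨-, hS⟩, -⟩ := hcov.existsUnique_continuousMap_lifts (ContinuousMap.id U) x₀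
    ⟨x₀, (0 : DiscreteReal)⟩ rfl
  have hproj : ∀ x : U, (S x).1 = x := fun x => congrFun hS x
  let v : U → ℝ := fun x => (S x).2
  -- In the trivialization at `i` the section is continuous with discrete values, hence locally
  -- constant. This says that `F x x + v x` equals `F i x + v i` for `x` near `i`.
  have hconst : ∀ i : U, ∀ᶠ x in nhds i, v x + (F x x - F i x) = v i := by
    intro i
    have hi : S i ∈ (Z.localTriv i).source := by
      rw [Z.mem_localTriv_source, hproj]
      exact Z.mem_baseSet_at i
    have hc : ContinuousAt (fun x => (Z.localTriv i (S x)).2) i :=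
      continuous_snd.continuousAt.comp
        (((Z.localTriv i).continuousAt hi).comp S.continuous.continuousAt)
    have hev := hc.eventually_mem (isOpen_discrete {(Z.localTriv i (S i)).2} |>.mem_nhds rfl)
    have hval : ∀ x, (Z.localTriv i (S x)).2 = v x + (F x x - F i x) := by
      intro x
      have : (Z.localTriv i (S x)).2 = v x + (F (S x).1 (S x).1 - F i (S x).1) := rfl
      rw [this, hproj]
    filter_upwards [hev] with x hx
    have hx' : (Z.localTriv i (S x)).2 = (Z.localTriv i (S i)).2 := hx
    rw [hval, hval] at hx'
    rw [hx']
    simp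
  refine ⟨fun x => if hx : x ∈ U then F ⟨x, hx⟩ x + v ⟨x, hx⟩ else 0, fun x hx => ?_⟩
  have h1 := (hF ⟨x, hx⟩ x (Metric.mem_ball_self (hr _))).add_const (v ⟨x, hx⟩)
  refine h1.congr_of_eventuallyEq ?_
  have h2 := hconst ⟨x, hx⟩
  rw [nhds_subtype_eq_comap, Filter.eventually_comap] at h2
  filter_upwards [h2, hU.mem_nhds hx] with y hy hyU
  have h3 := hy ⟨y, hyU⟩ rfl
  simp only [hyU, dif_pos]
  linarith

end Primitive

/-! ### Calculus of para-complex valued functions -/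

lemma star_ip : star ip = -ip := by
  ext <;> simp [ip]

lemma star_ofReal (r : ℝ) : star (algebraMap ℝ PC r) = algebraMap ℝ PC r := by
  ext <;> simp

lemma star_two : star (2 : PC) = 2 := by
  ext <;> simp

/-- The para-complex numbers have zero divisors, so cancellation is not available in general.
Numerals are nonzero reals and can be cancelled componentwise, which allows identities to be proved
after clearing the factors 1/2 in ∂ and ∂̄. -/
lemma mul_left_cancel_ofNat {n : ℕ} [n.AtLeastTwo] {x y : PC}
    (h : (OfNat.ofNat n : PC) * x = OfNat.ofNat n * y) : x = y := by
  have hn : (OfNat.ofNat n : ℝ) ≠ 0 := OfNat.ofNat_ne_zero n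
  have h1 := congrArg QuadraticAlgebra.re h
  have h2 := congrArg QuadraticAlgebra.im h
  simp only [QuadraticAlgebra.re_mul, QuadraticAlgebra.im_mul, QuadraticAlgebra.re_ofNat,
    QuadraticAlgebra.im_ofNat] at h1 h2
  ext
  · exact mul_left_cancel₀ hn (by linarith)
  · exact mul_left_cancel₀ hn (by linarith)

/-- Differentiability of a para-complex valued function. -/
def DiffAt (F : ℝ × ℝ → PC) (z : ℝ × ℝ) : Prop :=
  DifferentiableAt ℝ (fun p => (F p).re) z ∧ DifferentiableAt ℝ (fun p => (F p).im) z

/-- The derivative in the direction `v`. -/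
def pd (v : ℝ × ℝ) (F : ℝ × ℝ → PC) (z : ℝ × ℝ) : PC :=
  ⟨fderiv ℝ (fun p => (F p).re) z v, fderiv ℝ (fun p => (F p).im) z v⟩

lemma two_mul_dz (F : ℝ × ℝ → PC) (z : ℝ × ℝ) :
    2 * dz F z = pd (1, 0) F z + ip * pd (0, 1) F z := by
  rw [dz, show pdx F z = pd (1, 0) F z from rfl, show pdy F z = pd (0, 1) F z from rfl,
    mul_smul_comm, ← smul_mul_assoc]
  have : ((1 / 2 : ℝ) • (2 : PC)) = 1 := by
    ext <;> simp [QuadraticAlgebra.re_ofNat, QuadraticAlgebra.im_ofNat, QuadraticAlgebra.re_one,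
      QuadraticAlgebra.im_one]
  rw [this, one_mul]

lemma two_mul_dzbar (F : ℝ × ℝ → PC) (z : ℝ × ℝ) :
    2 * dzbar F z = pd (1, 0) F z - ip * pd (0, 1) F z := by
  rw [dzbar, show pdx F z = pd (1, 0) F z from rfl, show pdy F z = pd (0, 1) F z from rfl,
    mul_smul_comm, ← smul_mul_assoc]
  have : ((1 / 2 : ℝ) • (2 : PC)) = 1 := by
    ext <;> simp [QuadraticAlgebra.re_ofNat, QuadraticAlgebra.im_ofNat, QuadraticAlgebra.re_one,
      QuadraticAlgebra.im_one]
  rw [this, one_mul]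

section Rules

variable {F G : ℝ × ℝ → PC} {z : ℝ × ℝ}

lemma DiffAt.add (hF : DiffAt F z) (hG : DiffAt G z) : DiffAt (fun p => F p + G p) z :=
  ⟨hF.1.add hG.1, hF.2.add hG.2⟩

lemma DiffAt.sub (hF : DiffAt F z) (hG : DiffAt G z) : DiffAt (fun p => F p - G p) z :=
  ⟨hF.1.sub hG.1, hF.2.sub hG.2⟩

lemma DiffAt.mul (hF : DiffAt F z) (hG : DiffAt G z) : DiffAt (fun p => F p * G p) z := by
  constructor
  · simp only [QuadraticAlgebra.re_mul]
    exact (hF.1.mul hG.1).add ((hF.2.const_mul 1).mul hG.2)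
  · simp only [QuadraticAlgebra.im_mul]
    exact ((hF.1.mul hG.2).add (hF.2.mul hG.1)).add ((hF.2.const_mul 0).mul hG.2)

lemma DiffAt.star (hF : DiffAt F z) : DiffAt (fun p => star (F p)) z := by
  constructor
  · simpa using hF.1
  · simpa using hF.2

lemma DiffAt.const (c : PC) : DiffAt (fun _ => c) z :=
  ⟨differentiableAt_const _, differentiableAt_const _⟩

lemma pd_add (v : ℝ × ℝ) (hF : DiffAt F z) (hG : DiffAt G z) :
    pd v (fun p => F p + G p) z = pd v F z + pd v G z := by
  ext
  · simp [pd, fderiv_fun_add hF.1 hG.1]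
  · simp [pd, fderiv_fun_add hF.2 hG.2]

lemma pd_sub (v : ℝ × ℝ) (hF : DiffAt F z) (hG : DiffAt G z) :
    pd v (fun p => F p - G p) z = pd v F z - pd v G z := by
  ext
  · simp [pd, fderiv_fun_sub hF.1 hG.1]
  · simp [pd, fderiv_fun_sub hF.2 hG.2]

lemma pd_mul (v : ℝ × ℝ) (hF : DiffAt F z) (hG : DiffAt G z) :
    pd v (fun p => F p * G p) z = pd v F z * G z + F z * pd v G z := by
  ext
  · simp [pd, fderiv_fun_add (hF.1.fun_mul hG.1) (hF.2.fun_mul hG.2), fderiv_fun_mul hF.1 hG.1,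
      fderiv_fun_mul hF.2 hG.2]
    ring
  · simp [pd, fderiv_fun_add (hF.1.fun_mul hG.2) (hF.2.fun_mul hG.1), fderiv_fun_mul hF.1 hG.2,
      fderiv_fun_mul hF.2 hG.1]
    ring

lemma pd_star (v : ℝ × ℝ) (F : ℝ × ℝ → PC) (z : ℝ × ℝ) :
    pd v (fun p => star (F p)) z = star (pd v F z) := by
  ext
  · simp [pd]
  · simp [pd, fderiv_fun_neg]

lemma pd_const (v : ℝ × ℝ) (c : PC) : pd v (fun _ => c) z = 0 := by
  ext <;> simp [pd]

lemma pd_congr (v : ℝ × ℝ) (h : F =ᶠ[nhds z] G) : pd v F z = pd v G z := by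
  have h1 : (fun p => (F p).re) =ᶠ[nhds z] fun p => (G p).re := h.fun_comp _
  have h2 : (fun p => (F p).im) =ᶠ[nhds z] fun p => (G p).im := h.fun_comp _
  rw [pd, pd, h1.fderiv_eq, h2.fderiv_eq]

lemma dz_congr (h : F =ᶠ[nhds z] G) : dz F z = dz G z :=
  mul_left_cancel_ofNat (n := 2) (by rw [two_mul_dz, two_mul_dz, pd_congr _ h, pd_congr _ h])

lemma dzbar_congr (h : F =ᶠ[nhds z] G) : dzbar F z = dzbar G z :=
  mul_left_cancel_ofNat (n := 2) (by rw [two_mul_dzbar, two_mul_dzbar, pd_congr _ h, pd_congr _ h])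

lemma dz_star (F : ℝ × ℝ → PC) (z : ℝ × ℝ) : dz (fun p => star (F p)) z = star (dzbar F z) := by
  refine mul_left_cancel_ofNat (n := 2) ?_
  have h := congrArg star (two_mul_dzbar F z)
  rw [star_mul', star_two, star_sub, star_mul', star_ip] at h
  rw [two_mul_dz, h, pd_star, pd_star]
  ring

lemma dzbar_star (F : ℝ × ℝ → PC) (z : ℝ × ℝ) : dzbar (fun p => star (F p)) z = star (dz F z) := by
  refine mul_left_cancel_ofNat (n := 2) ?_
  have h := congrArg star (two_mul_dz F z)
  rw [star_mul', star_two, star_add, star_mul', star_ip] at h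
  rw [two_mul_dzbar, h, pd_star, pd_star]
  ring

lemma dz_sub (hF : DiffAt F z) (hG : DiffAt G z) :
    dz (fun p => F p - G p) z = dz F z - dz G z := by
  refine mul_left_cancel_ofNat (n := 2) ?_
  rw [mul_sub, two_mul_dz, two_mul_dz, two_mul_dz, pd_sub _ hF hG, pd_sub _ hF hG]
  ring

lemma dz_mul (hF : DiffAt F z) (hG : DiffAt G z) :
    dz (fun p => F p * G p) z = dz F z * G z + F z * dz G z := by
  refine mul_left_cancel_ofNat (n := 2) ?_
  have h1 := two_mul_dz F z
  have h2 := two_mul_dz G z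
  rw [two_mul_dz, pd_mul _ hF hG, pd_mul _ hF hG]
  linear_combination -G z * h1 - F z * h2

lemma dz_const (c : PC) : dz (fun _ => c) z = 0 := by
  refine mul_left_cancel_ofNat (n := 2) ?_
  rw [two_mul_dz, pd_const, pd_const]
  ring

lemma dz_const_mul (c : PC) (hF : DiffAt F z) : dz (fun p => c * F p) z = c * dz F z := by
  rw [dz_mul (DiffAt.const c) hF, dz_const]
  ring

lemma dzbar_add (hF : DiffAt F z) (hG : DiffAt G z) :
    dzbar (fun p => F p + G p) z = dzbar F z + dzbar G z := by
  refine mul_left_cancel_ofNat (n := 2) ?_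
  rw [mul_add, two_mul_dzbar, two_mul_dzbar, two_mul_dzbar, pd_add _ hF hG, pd_add _ hF hG]
  ring

lemma dzbar_sub (hF : DiffAt F z) (hG : DiffAt G z) :
    dzbar (fun p => F p - G p) z = dzbar F z - dzbar G z := by
  refine mul_left_cancel_ofNat (n := 2) ?_
  rw [mul_sub, two_mul_dzbar, two_mul_dzbar, two_mul_dzbar, pd_sub _ hF hG, pd_sub _ hF hG]
  ring

lemma dzbar_mul (hF : DiffAt F z) (hG : DiffAt G z) :
    dzbar (fun p => F p * G p) z = dzbar F z * G z + F z * dzbar G z := by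
  refine mul_left_cancel_ofNat (n := 2) ?_
  have h1 := two_mul_dzbar F z
  have h2 := two_mul_dzbar G z
  rw [two_mul_dzbar, pd_mul _ hF hG, pd_mul _ hF hG]
  linear_combination -G z * h1 - F z * h2

lemma dzbar_const (c : PC) : dzbar (fun _ => c) z = 0 := by
  refine mul_left_cancel_ofNat (n := 2) ?_
  rw [two_mul_dzbar, pd_const, pd_const]
  ring

lemma dzbar_const_mul (c : PC) (hF : DiffAt F z) :
    dzbar (fun p => c * F p) z = c * dzbar F z := by
  rw [dzbar_mul (DiffAt.const c) hF, dzbar_const]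
  ring

end Rules

/-! ### Smooth para-complex functions and commuting derivatives -/

section Smooth

variable {F G : ℝ × ℝ → PC} {W : Set (ℝ × ℝ)}

lemma SmoothOn.add (hF : SmoothOn F W) (hG : SmoothOn G W) : SmoothOn (fun p => F p + G p) W :=
  ⟨hF.1.add hG.1, hF.2.add hG.2⟩

lemma SmoothOn.sub (hF : SmoothOn F W) (hG : SmoothOn G W) : SmoothOn (fun p => F p - G p) W :=
  ⟨hF.1.sub hG.1, hF.2.sub hG.2⟩

lemma SmoothOn.const (c : PC) : SmoothOn (fun _ => c) W :=
  ⟨contDiffOn_const, contDiffOn_const⟩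

lemma SmoothOn.mul (hF : SmoothOn F W) (hG : SmoothOn G W) : SmoothOn (fun p => F p * G p) W := by
  constructor
  · simp only [QuadraticAlgebra.re_mul]
    exact (hF.1.mul hG.1).add ((contDiffOn_const.mul hF.2).mul hG.2)
  · simp only [QuadraticAlgebra.im_mul]
    exact ((hF.1.mul hG.2).add (hF.2.mul hG.1)).add ((contDiffOn_const.mul hF.2).mul hG.2)

lemma SmoothOn.star (hF : SmoothOn F W) : SmoothOn (fun p => star (F p)) W := by
  constructor
  · simpa using hF.1
  · simpa using hF.2.neg

lemma SmoothOn.congr (hF : SmoothOn F W) (h : ∀ z ∈ W, G z = F z) : SmoothOn G W :=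
  ⟨hF.1.congr fun z hz => by rw [h z hz], hF.2.congr fun z hz => by rw [h z hz]⟩

lemma SmoothOn.mono {V : Set (ℝ × ℝ)} (hF : SmoothOn F W) (h : V ⊆ W) : SmoothOn F V :=
  ⟨hF.1.mono h, hF.2.mono h⟩

lemma SmoothOn.diffAt (hW : IsOpen W) (hF : SmoothOn F W) {z : ℝ × ℝ} (hz : z ∈ W) :
    DiffAt F z :=
  ⟨(hF.1.contDiffAt (hW.mem_nhds hz)).differentiableAt (by simp),
    (hF.2.contDiffAt (hW.mem_nhds hz)).differentiableAt (by simp)⟩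

lemma contDiffOn_fderiv_apply {V : Type*} [NormedAddCommGroup V] [NormedSpace ℝ V]
    (hW : IsOpen W) {g : ℝ × ℝ → V} (hg : ContDiffOn ℝ ∞ g W) (v : ℝ × ℝ) :
    ContDiffOn ℝ ∞ (fun z => fderiv ℝ g z v) W :=
  ((contDiffOn_infty_iff_fderiv_of_isOpen hW).1 hg).2.clm_apply contDiffOn_const

lemma SmoothOn.pd (hW : IsOpen W) (hF : SmoothOn F W) (v : ℝ × ℝ) : SmoothOn (pd v F) W :=
  ⟨contDiffOn_fderiv_apply hW hF.1 v, contDiffOn_fderiv_apply hW hF.2 v⟩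

lemma dz_eq (F : ℝ × ℝ → PC) (z : ℝ × ℝ) :
    dz F z = algebraMap ℝ PC (1 / 2) * (NilT.pd (1, 0) F z + ip * NilT.pd (0, 1) F z) := by
  rw [← Algebra.smul_def]
  rfl

lemma dzbar_eq (F : ℝ × ℝ → PC) (z : ℝ × ℝ) :
    dzbar F z = algebraMap ℝ PC (1 / 2) * (NilT.pd (1, 0) F z - ip * NilT.pd (0, 1) F z) := by
  rw [← Algebra.smul_def]
  rfl

lemma SmoothOn.dz (hW : IsOpen W) (hF : SmoothOn F W) : SmoothOn (dz F) W :=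
  ((SmoothOn.const _).mul ((hF.pd hW (1, 0)).add ((SmoothOn.const ip).mul (hF.pd hW (0, 1))))).congr
    fun z _ => dz_eq F z

lemma SmoothOn.dzbar (hW : IsOpen W) (hF : SmoothOn F W) : SmoothOn (dzbar F) W :=
  ((SmoothOn.const _).mul ((hF.pd hW (1, 0)).sub ((SmoothOn.const ip).mul (hF.pd hW (0, 1))))).congr
    fun z _ => dzbar_eq F z

lemma fderiv_fderiv_apply_comm {V : Type*} [NormedAddCommGroup V] [NormedSpace ℝ V]
    (hW : IsOpen W) {g : ℝ × ℝ → V} (hg : ContDiffOn ℝ ∞ g W) {z : ℝ × ℝ} (hz : z ∈ W)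
    (v w : ℝ × ℝ) :
    fderiv ℝ (fun p => fderiv ℝ g p v) z w = fderiv ℝ (fun p => fderiv ℝ g p w) z v := by
  have hd : DifferentiableAt ℝ (fderiv ℝ g) z :=
    (((contDiffOn_infty_iff_fderiv_of_isOpen hW).1 hg).2.contDiffAt
      (hW.mem_nhds hz)).differentiableAt (by simp)
  have hs := (hg.contDiffAt (hW.mem_nhds hz)).isSymmSndFDerivAt (by
    rw [minSmoothness_of_isRCLikeNormedField]
    exact WithTop.coe_le_coe.2 (le_top : (2 : ℕ∞) ≤ ⊤))
  rw [fderiv_clm_apply hd (differentiableAt_const _), fderiv_clm_apply hd (differentiableAt_const _)]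
  simpa using hs w v

lemma pd_comm (hW : IsOpen W) (hF : SmoothOn F W) {z : ℝ × ℝ} (hz : z ∈ W) (v w : ℝ × ℝ) :
    NilT.pd w (NilT.pd v F) z = NilT.pd v (NilT.pd w F) z := by
  ext
  · exact fderiv_fderiv_apply_comm hW hF.1 hz v w
  · exact fderiv_fderiv_apply_comm hW hF.2 hz v w

lemma dzbar_dz_comm (hW : IsOpen W) (hF : SmoothOn F W) {z : ℝ × ℝ} (hz : z ∈ W) :
    NilT.dzbar (NilT.dz F) z = NilT.dz (NilT.dzbar F) z := by
  have d1 := (hF.pd hW (1, 0)).diffAt hW hz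
  have d2 := (hF.pd hW (0, 1)).diffAt hW hz
  have c := DiffAt.const (z := z) ip
  rw [funext (dz_eq F), funext (dzbar_eq F), dzbar_const_mul _ (d1.add (c.mul d2)),
    dz_const_mul _ (d1.sub (c.mul d2)), dzbar_add d1 (c.mul d2), dz_sub d1 (c.mul d2),
    dzbar_const_mul _ d2, dz_const_mul _ d2]
  refine mul_left_cancel_ofNat (n := 2) ?_
  have h := pd_comm hW hF hz (1, 0) (0, 1)
  have e1 := two_mul_dzbar (NilT.pd (1, 0) F) z
  have e2 := two_mul_dzbar (NilT.pd (0, 1) F) z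
  have e3 := two_mul_dz (NilT.pd (1, 0) F) z
  have e4 := two_mul_dz (NilT.pd (0, 1) F) z
  linear_combination algebraMap ℝ PC (1 / 2) * (e1 + ip * e2 - e3 + ip * e4 - 2 * ip * h)

end Smooth

/-! ### The equation of minimal surfaces in terms of spinors -/

/-- The equation `∂_z̄ φ = …` for the left-translated derivative of a minimal conformal map. -/
def HarmonicEq (q : Fin 3 → ℝ × ℝ → PC) (z : ℝ × ℝ) : Prop :=
  2 * dzbar (q 0) z = q 1 z * star (q 2 z) + star (q 1 z) * q 2 z ∧
  2 * dzbar (q 1) z = q 0 z * star (q 2 z) + star (q 0 z) * q 2 z ∧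
  2 * dzbar (q 2) z = q 0 z * star (q 1 z) - star (q 0 z) * q 1 z

/-- The components of `f⁻¹ f_z` in terms of `a = ψ₁` and `b = ψ̄₂`. -/
def spinForm (σ : PC) (a b : ℝ × ℝ → PC) : Fin 3 → ℝ × ℝ → PC :=
  ![fun z => σ * (b z * b z + a z * a z), fun z => σ * ip * (b z * b z - a z * a z),
    fun z => 2 * (a z * b z)]

/-- The support function `2 (b b̄ - a ā)` with values in the para-complex numbers. -/
def supp (a b : ℝ × ℝ → PC) (z : ℝ × ℝ) : PC := 2 * (b z * star (b z) - a z * star (a z))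

/-- The Dirac equation with potential `i' h / 4`, for `a = ψ₁` and `b = ψ̄₂`. -/
def DiracEq (a b : ℝ × ℝ → PC) (z : ℝ × ℝ) : Prop :=
  4 * dzbar a z = ip * (supp a b z * star (b z)) ∧
  4 * dzbar b z = ip * (supp a b z * star (a z))

lemma star_supp (a b : ℝ × ℝ → PC) (z : ℝ × ℝ) : star (supp a b z) = supp a b z := by
  simp only [supp, star_mul', star_sub, star_star, star_two]
  ring

section Algebra

variable {σ : PC} {a b : ℝ × ℝ → PC} {z : ℝ × ℝ}

lemma dzbar_mul_self {F : ℝ × ℝ → PC} (hF : DiffAt F z) :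
    dzbar (fun p => F p * F p) z = 2 * (F z * dzbar F z) := by
  rw [dzbar_mul hF hF]
  ring

lemma dzbar_spinForm (ha : DiffAt a z) (hb : DiffAt b z) :
    dzbar (spinForm σ a b 0) z = σ * (2 * (b z * dzbar b z) + 2 * (a z * dzbar a z)) ∧
    dzbar (spinForm σ a b 1) z = σ * ip * (2 * (b z * dzbar b z) - 2 * (a z * dzbar a z)) ∧
    dzbar (spinForm σ a b 2) z = 2 * (dzbar a z * b z + a z * dzbar b z) := by
  refine ⟨?_, ?_, ?_⟩
  · change dzbar (fun z => σ * (b z * b z + a z * a z)) z = _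
    rw [dzbar_const_mul _ ((hb.mul hb).add (ha.mul ha)), dzbar_add (hb.mul hb) (ha.mul ha),
      dzbar_mul_self hb, dzbar_mul_self ha]
  · change dzbar (fun z => σ * ip * (b z * b z - a z * a z)) z = _
    rw [dzbar_const_mul _ ((hb.mul hb).sub (ha.mul ha)), dzbar_sub (hb.mul hb) (ha.mul ha),
      dzbar_mul_self hb, dzbar_mul_self ha]
  · change dzbar (fun z => 2 * (a z * b z)) z = _
    rw [dzbar_const_mul _ (ha.mul hb), dzbar_mul ha hb]

lemma sq_sign (hσ : σ = ip ∨ σ = -ip) : σ * σ = 1 := by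
  rcases hσ with rfl | rfl
  · exact ip_mul_ip
  · rw [neg_mul_neg, ip_mul_ip]

lemma star_sign (hσ : σ = ip ∨ σ = -ip) : star σ = -σ := by
  rcases hσ with rfl | rfl
  · exact star_ip
  · rw [star_neg, star_ip]

/-- Let X, Y be the defects of the two Dirac equations. The system gives aX = 0, bY = 0 and bX + aY
= 0. Hence b²X = -a(bY) = 0, while jh = 1 and aX = 0 give X = 2j b̄ b X; applying this twice yields
X = 0. The argument for Y is symmetric. Invertibility of h replaces division by a or b, which may be
zero divisors. -/
theorem diracEq_of_harmonicEq (hσ : σ = ip ∨ σ = -ip) (ha : DiffAt a z) (hb : DiffAt b z)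
    {j : PC} (hj : j * supp a b z = 1) (h : HarmonicEq (spinForm σ a b) z) : DiracEq a b z := by
  obtain ⟨d0, d1, d2⟩ := dzbar_spinForm (σ := σ) ha hb
  obtain ⟨h0, h1, h2⟩ := h
  have s2 := sq_sign hσ
  have i2 := ip_mul_ip
  rw [d0] at h0
  rw [d1] at h1
  rw [d2] at h2
  simp only [spinForm, Matrix.cons_val_zero, Matrix.cons_val_one, Matrix.cons_val, star_mul',
    star_add, star_sub, star_ip, star_sign hσ, star_two] at h0 h1 h2
  rw [DiracEq]
  rw [supp] at *
  generalize dzbar a z = x at *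
  generalize dzbar b z = y at *
  generalize a z = A at *
  generalize b z = C at *
  generalize star A = A' at *
  generalize star C = C' at *
  -- The sum and difference of the first two equations, the second multiplied by i', isolate the
  -- terms in b∂̄b and a∂̄a. The third equation supplies the mixed relation.
  have eA : A * (4 * x - ip * (2 * (C * C' - A * A') * C')) = 0 :=
    mul_left_cancel_ofNat (n := 2) (by grind)
  have eC : C * (4 * y - ip * (2 * (C * C' - A * A') * A')) = 0 :=
    mul_left_cancel_ofNat (n := 2) (by grind)
  have eAC : C * (4 * x - ip * (2 * (C * C' - A * A') * C'))
      + A * (4 * y - ip * (2 * (C * C' - A * A') * A')) = 0 := by grind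
  clear h0 h1 h2 d0 d1 d2
  constructor
  · rw [← sub_eq_zero]
    generalize 4 * x - ip * (2 * (C * C' - A * A') * C') = X at *
    generalize 4 * y - ip * (2 * (C * C' - A * A') * A') = Y at *
    grind
  · rw [← sub_eq_zero]
    generalize 4 * x - ip * (2 * (C * C' - A * A') * C') = X at *
    generalize 4 * y - ip * (2 * (C * C' - A * A') * A') = Y at *
    grind

lemma DiracEq.conj (h : DiracEq a b z) :
    4 * star (dzbar a z) = -(ip * (supp a b z * b z)) ∧
    4 * star (dzbar b z) = -(ip * (supp a b z * a z)) := by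
  have h4 : star (4 : PC) = 4 := by ext <;> simp
  constructor
  · have := congrArg star h.1
    simpa only [star_mul', h4, star_ip, star_supp, star_star, neg_mul] using this
  · have := congrArg star h.2
    simpa only [star_mul', h4, star_ip, star_supp, star_star, neg_mul] using this

lemma DiffAt.supp (ha : DiffAt a z) (hb : DiffAt b z) : DiffAt (supp a b) z :=
  (DiffAt.const 2).mul ((hb.mul hb.star).sub (ha.mul ha.star))

/-- The terms b∂b̄ and a∂ā are both equal to -i'h ab/4 by the conjugated Dirac equations, so they
cancel in ∂h. -/
lemma dz_supp (ha : DiffAt a z) (hb : DiffAt b z) (h : DiracEq a b z) :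
    dz (supp a b) z = 2 * (dz b z * star (b z) - dz a z * star (a z)) := by
  change dz (fun z => 2 * (b z * star (b z) - a z * star (a z))) z = _
  rw [dz_const_mul _ ((hb.mul hb.star).sub (ha.mul ha.star)),
    dz_sub (hb.mul hb.star) (ha.mul ha.star), dz_mul hb hb.star, dz_mul ha ha.star, dz_star, dz_star]
  obtain ⟨h1, h2⟩ := h.conj
  refine mul_left_cancel_ofNat (n := 2) ?_
  linear_combination b z * h2 - a z * h1

lemma dzbar_supp (ha : DiffAt a z) (hb : DiffAt b z) (h : DiracEq a b z) :
    dzbar (supp a b) z = 2 * (star (dz b z) * b z - star (dz a z) * a z) := by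
  have := dzbar_star (supp a b) z
  simp only [star_supp] at this
  rw [this, dz_supp ha hb h, star_mul', star_two, star_sub, star_mul', star_mul', star_star,
    star_star]

end Algebra

/-- `a ∂b - b ∂a`. -/
def wronskian (a b : ℝ × ℝ → PC) (z : ℝ × ℝ) : PC := a z * dz b z - b z * dz a z

section Wronskian

variable {W : Set (ℝ × ℝ)} {a b : ℝ × ℝ → PC} {z : ℝ × ℝ}

/-- The Abresch-Rosenberg differential of a minimal surface is para-holomorphic. -/
theorem dzbar_wronskian (hW : IsOpen W) (ha : SmoothOn a W) (hb : SmoothOn b W)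
    (h : ∀ z ∈ W, DiracEq a b z) (hz : z ∈ W) : dzbar (wronskian a b) z = 0 := by
  have da := ha.diffAt hW hz
  have db := hb.diffAt hW hz
  have da' := (ha.dz hW).diffAt hW hz
  have db' := (hb.dz hW).diffAt hW hz
  have ds := DiffAt.supp da db
  have ev := hW.mem_nhds hz
  have e1 : 4 * dz (dzbar a) z = ip * (dz (supp a b) z * star (b z)
      + supp a b z * star (dzbar b z)) := by
    rw [← dz_const_mul _ ((ha.dzbar hW).diffAt hW hz), dz_congr (G := fun p =>
      ip * (supp a b p * star (b p))) (Filter.eventually_of_mem ev fun p hp => (h p hp).1),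
      dz_const_mul _ (ds.mul db.star), dz_mul ds db.star, dz_star]
  have e2 : 4 * dz (dzbar b) z = ip * (dz (supp a b) z * star (a z)
      + supp a b z * star (dzbar a z)) := by
    rw [← dz_const_mul _ ((hb.dzbar hW).diffAt hW hz), dz_congr (G := fun p =>
      ip * (supp a b p * star (a p))) (Filter.eventually_of_mem ev fun p hp => (h p hp).2),
      dz_const_mul _ (ds.mul da.star), dz_mul ds da.star, dz_star]
  obtain ⟨h1, h2⟩ := h z hz
  obtain ⟨h3, h4⟩ := (h z hz).conj
  have hs := dz_supp da db (h z hz)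
  change dzbar (fun z => a z * dz b z - b z * dz a z) z = 0
  rw [dzbar_sub (da.mul db') (db.mul da'), dzbar_mul da db', dzbar_mul db da',
    dzbar_dz_comm hW ha hz, dzbar_dz_comm hW hb hz]
  have hsupp : supp a b z = 2 * (b z * star (b z) - a z * star (a z)) := rfl
  have i2 := ip_mul_ip
  refine mul_left_cancel_ofNat (n := 4) ?_
  generalize dz (supp a b) z = S at *
  generalize supp a b z = H at *
  generalize dz (dzbar a) z = a2 at *
  generalize dz (dzbar b) z = b2 at *
  generalize star (dzbar a z) = xc at *
  generalize star (dzbar b z) = yc at *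
  generalize dzbar a z = x at *
  generalize dzbar b z = y at *
  generalize dz a z = x' at *
  generalize dz b z = y' at *
  generalize star (a z) = A' at *
  generalize star (b z) = C' at *
  generalize a z = A at *
  generalize b z = C at *
  refine mul_left_cancel_ofNat (n := 4) ?_
  -- Differentiating the Dirac equations gives 16∂∂̄a and 16∂∂̄b. In a∂∂̄b - b∂∂̄a the h² terms
  -- cancel and -i'h∂h/8 remains; the first-order products ∂̄a∂b - ∂̄b∂a contribute the opposite
  -- amount.
  have e1' : 16 * a2 = 4 * ip * S * C' - H * H * A := by
    linear_combination 4 * e1 + ip * H * h4 - H * H * A * i2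
  have e2' : 16 * b2 = 4 * ip * S * A' - H * H * C := by
    linear_combination 4 * e2 + ip * H * h3 - H * H * C * i2
  linear_combination 4 * y' * h1 - 4 * x' * h2 + A * e2' - C * e1' - 2 * ip * H * hs
    + 2 * ip * S * hsupp

end Wronskian

/-! ### The dual one-form -/

/-- The components of `g⁻¹ g_z` for the dual surface `g`: the conjugates of those of the given
surface, multiplied by `16 B / h²` (with `J = 1 / h`). -/
def dualForm (σ : PC) (a b J B : ℝ × ℝ → PC) (k : Fin 3) (z : ℝ × ℝ) : PC :=
  16 * (B z * (J z * J z)) * star (spinForm σ a b k z)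

section DualForm

variable {σ : PC} {a b J B : ℝ × ℝ → PC} {z : ℝ × ℝ}

lemma dzbar_inv_supp (ha : DiffAt a z) (hb : DiffAt b z) (hJ : DiffAt J z) (h : DiracEq a b z)
    (hJs : ∀ᶠ p in nhds z, J p * supp a b p = 1) :
    dzbar J z = -(J z * J z * (2 * (star (dz b z) * b z - star (dz a z) * a z))) := by
  have h1 : dzbar (fun p => J p * supp a b p) z = 0 := by
    rw [dzbar_congr (G := fun _ => 1) hJs, dzbar_const]
  rw [dzbar_mul hJ (DiffAt.supp ha hb), dzbar_supp ha hb h] at h1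
  have h2 := hJs.self_of_nhds
  linear_combination J z * h1 - dzbar J z * h2

/-- After the quotient rule, the numerator of ∂̄(ā/h) is h·conj(∂a) - 2ā(b·conj(∂b) - a·conj(∂a)).
The terms in a ā cancel and leave -2b times the conjugate wronskian, which is 2i'B̄. The case of
b̄/h is the same. -/
lemma dzbar_inv_mul_star (ha : DiffAt a z) (hb : DiffAt b z) (hJ : DiffAt J z) (h : DiracEq a b z)
    (hJs : ∀ᶠ p in nhds z, J p * supp a b p = 1) (hB : 2 * B z = -(ip * wronskian a b z)) :
    dzbar (fun p => J p * star (a p)) z = -(4 * ip * (b z * star (B z) * (J z * J z))) ∧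
    dzbar (fun p => J p * star (b p)) z = -(4 * ip * (a z * star (B z) * (J z * J z))) := by
  have h1 := dzbar_inv_supp ha hb hJ h hJs
  have hJ1 : J z * (2 * (b z * star (b z) - a z * star (a z))) = 1 := hJs.self_of_nhds
  have hBs : 2 * star (B z) = ip * (star (a z) * star (dz b z) - star (b z) * star (dz a z)) := by
    have := congrArg star hB
    simpa only [wronskian, star_mul', star_two, star_neg, star_ip, star_sub, neg_mul,
      neg_neg] using this
  have i2 := ip_mul_ip
  rw [dzbar_mul hJ ha.star, dzbar_mul hJ hb.star, dzbar_star, dzbar_star, h1]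
  generalize star (dz a z) = α at *
  generalize star (dz b z) = β at *
  generalize star (B z) = B' at *
  generalize star (a z) = A' at *
  generalize star (b z) = C' at *
  constructor
  · linear_combination (-α * J z) * hJ1 + 2 * ip * b z * J z * J z * hBs
      + 2 * (A' * β - C' * α) * b z * J z * J z * i2
  · linear_combination (-β * J z) * hJ1 + 2 * ip * a z * J z * J z * hBs
      + 2 * (A' * β - C' * α) * a z * J z * J z * i2

/-- Since ∂̄B = 0, the derivative falls only on products of ā/h and b̄/h, and each becomes a
multiple of BB̄/h³. The right-hand sides are multiples of BB̄/h⁴ that contain a factor h, so the two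
sides match by `J` · h = 1. -/
theorem harmonicEq_dualForm (hσ : σ = ip ∨ σ = -ip) (ha : DiffAt a z) (hb : DiffAt b z)
    (hJ : DiffAt J z) (hBd : DiffAt B z) (h : DiracEq a b z)
    (hJs : ∀ᶠ p in nhds z, J p * supp a b p = 1) (hJr : star (J z) = J z)
    (hB : 2 * B z = -(ip * wronskian a b z)) (hB0 : dzbar B z = 0) :
    HarmonicEq (dualForm σ a b J B) z := by
  obtain ⟨hP, hM⟩ := dzbar_inv_mul_star ha hb hJ h hJs hB
  have hJ1 : J z * (2 * (b z * star (b z) - a z * star (a z))) = 1 := hJs.self_of_nhds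
  have dP : DiffAt (fun p => J p * star (a p)) z := hJ.mul ha.star
  have dM : DiffAt (fun p => J p * star (b p)) z := hJ.mul hb.star
  have hss := star_sign hσ
  have e0 : dualForm σ a b J B 0 = fun p => (-16 * σ) * (B p *
      ((J p * star (a p)) * (J p * star (a p)) + (J p * star (b p)) * (J p * star (b p)))) := by
    funext p
    simp only [dualForm, spinForm, Matrix.cons_val_zero, star_mul', star_add, hss]
    ring
  have e1 : dualForm σ a b J B 1 = fun p => (16 * σ * ip) * (B p *
      ((J p * star (b p)) * (J p * star (b p)) - (J p * star (a p)) * (J p * star (a p)))) := by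
    funext p
    simp only [dualForm, spinForm, Matrix.cons_val_one, Matrix.cons_val_zero, star_mul', star_sub,
      hss, star_ip]
    ring
  have e2 : dualForm σ a b J B 2 = fun p => 32 * (B p *
      ((J p * star (a p)) * (J p * star (b p)))) := by
    funext p
    simp only [dualForm, spinForm, Matrix.cons_val, star_mul', star_two]
    ring
  have d0 : dzbar (dualForm σ a b J B 0) z = -16 * σ * (B z * (2 * (J z * star (a z) *
      -(4 * ip * (b z * star (B z) * (J z * J z)))) + 2 * (J z * star (b z) *
      -(4 * ip * (a z * star (B z) * (J z * J z)))))) := by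
    rw [e0, dzbar_const_mul _ (hBd.mul ((dP.mul dP).add (dM.mul dM))),
      dzbar_mul hBd ((dP.mul dP).add (dM.mul dM)), hB0, dzbar_add (dP.mul dP) (dM.mul dM),
      dzbar_mul_self dP, dzbar_mul_self dM, hP, hM]
    ring
  have d1 : dzbar (dualForm σ a b J B 1) z = 16 * σ * ip * (B z * (2 * (J z * star (b z) *
      -(4 * ip * (a z * star (B z) * (J z * J z)))) - 2 * (J z * star (a z) *
      -(4 * ip * (b z * star (B z) * (J z * J z)))))) := by
    rw [e1, dzbar_const_mul _ (hBd.mul ((dM.mul dM).sub (dP.mul dP))),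
      dzbar_mul hBd ((dM.mul dM).sub (dP.mul dP)), hB0, dzbar_sub (dM.mul dM) (dP.mul dP),
      dzbar_mul_self dP, dzbar_mul_self dM, hP, hM]
    ring
  have d2 : dzbar (dualForm σ a b J B 2) z = 32 * (B z *
      (-(4 * ip * (b z * star (B z) * (J z * J z))) * (J z * star (b z)) +
      J z * star (a z) * -(4 * ip * (a z * star (B z) * (J z * J z))))) := by
    rw [e2, dzbar_const_mul _ (hBd.mul (dP.mul dM)), dzbar_mul hBd (dP.mul dM), hB0,
      dzbar_mul dP dM, hP, hM]
    ring
  have s2 := sq_sign hσ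
  have i2 := ip_mul_ip
  have h16 : star (16 : PC) = 16 := by ext <;> simp
  rw [HarmonicEq, d0, d1, d2]
  simp only [dualForm, spinForm, Matrix.cons_val_zero, Matrix.cons_val_one, Matrix.cons_val,
    star_mul', star_add, star_sub, star_star, star_neg, hss, star_ip, neg_neg, hJr, h16, star_two]
  clear hP hM e0 e1 e2 d0 d1 d2 dP dM hJs h hB hB0 ha hb hJ hBd hJr
  generalize star (B z) = B' at *
  generalize star (a z) = A' at *
  generalize star (b z) = C' at *
  generalize a z = A at *
  generalize b z = C at *
  generalize J z = j at *
  generalize B z = b at *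
  refine ⟨?_, ?_, ?_⟩
  · linear_combination (-256 * σ * ip * b * B' * j ^ 3 * (A' * C + C' * A)) * hJ1
  · linear_combination (256 * σ * b * B' * j ^ 3 * (A * C' - A' * C)) * hJ1
      - 256 * σ * b * B' * j ^ 3 * (A * C' - A' * C) * i2
  · linear_combination (256 * ip * b * B' * j ^ 3 * (C * C' + A * A')) * hJ1
      + 512 * ip * b * B' * j ^ 4 * (C ^ 2 * C' ^ 2 - A ^ 2 * A' ^ 2) * s2

end DualForm

/-! ### The structure equations of surfaces -/

/-- In signature (-,+,+) the Gram determinant of X, Y, N is minus the square of their determinant.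
Here it equals -e², so the three vectors form a basis and only 0 is orthogonal to all of them. -/
lemma lip_nondegenerate {X Y N T : Vec3} {e : ℝ} (he : e ≠ 0) (hE : lip X X = e)
    (hF : lip X Y = 0) (hG : lip Y Y = -e) (hN : lip N N = 1) (hNX : lip N X = 0)
    (hNY : lip N Y = 0) (hX : lip T X = 0) (hY : lip T Y = 0) (hT : lip T N = 0) : T = 0 := by
  let M : Matrix (Fin 3) (Fin 3) ℝ :=
    !![-X 0, X 1, X 2; -Y 0, Y 1, Y 2; -N 0, N 1, N 2]
  have hdet : M.det ^ 2 = -(lip X X * (lip Y Y * lip N N - lip N Y * lip N Y)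
      - lip X Y * (lip X Y * lip N N - lip N Y * lip N X)
      + lip N X * (lip X Y * lip N Y - lip Y Y * lip N X)) := by
    simp only [M, Matrix.det_fin_three, lip, Matrix.of_apply, Matrix.cons_val', Matrix.cons_val_zero,
      Matrix.cons_val_one, Matrix.cons_val, Matrix.cons_val_fin_one]
    ring
  have hdet0 : M.det ≠ 0 := by
    intro h0
    rw [h0, hE, hF, hG, hN, hNX, hNY] at hdet
    apply he
    nlinarith
  refine Matrix.eq_zero_of_mulVec_eq_zero hdet0 ?_
  simp only [lip] at hX hY hT
  ext i
  fin_cases i <;> simp [M, Matrix.mulVec, dotProduct, Fin.sum_univ_three] <;> linarith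

section Structure

variable {W : Set (ℝ × ℝ)} {f N : ℝ × ℝ → Vec3} {z : ℝ × ℝ}

lemma fderiv_coord (g : ℝ × ℝ → Vec3) (hg : DifferentiableAt ℝ g z) (v : ℝ × ℝ) (k : Fin 3) :
    fderiv ℝ g z v k = fderiv ℝ (fun p => g p k) z v := by
  rw [differentiableAt_pi] at hg
  rw [show g = fun p i => g p i from rfl, fderiv_pi hg]
  rfl

lemma contDiffOn_leftPull (hW : IsOpen W) (hf : ContDiffOn ℝ ∞ f W) (v : ℝ × ℝ) :
    ContDiffOn ℝ ∞ (fun z => leftPull (f z) (fderiv ℝ f z v)) W := by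
  have h1 := contDiffOn_pi.1 hf
  have h2 := contDiffOn_pi.1 (contDiffOn_fderiv_apply hW hf v)
  rw [contDiffOn_pi]
  intro i
  fin_cases i
  · exact h2 0
  · exact h2 1
  · exact (h2 2).add (contDiffOn_const.mul (((h1 1).mul (h2 0)).sub ((h1 0).mul (h2 1))))

lemma contDiffOn_mcX (hW : IsOpen W) (hf : ContDiffOn ℝ ∞ f W) : ContDiffOn ℝ ∞ (mcX f) W :=
  contDiffOn_leftPull hW hf _

lemma contDiffOn_mcY (hW : IsOpen W) (hf : ContDiffOn ℝ ∞ f W) : ContDiffOn ℝ ∞ (mcY f) W :=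
  contDiffOn_leftPull hW hf _

lemma differentiableAt_of_smooth {V : Type*} [NormedAddCommGroup V] [NormedSpace ℝ V]
    {g : ℝ × ℝ → V} (hW : IsOpen W) (hg : ContDiffOn ℝ ∞ g W) (hz : z ∈ W) :
    DifferentiableAt ℝ g z :=
  (hg.contDiffAt (hW.mem_nhds hz)).differentiableAt (by simp)

lemma two_mul_dzbar_phi (hW : IsOpen W) (hf : ContDiffOn ℝ ∞ f W) (hz : z ∈ W) (k : Fin 3) :
    2 * dzbar (phi f k) z =
      ⟨(fderiv ℝ (mcX f) z (1, 0) k - fderiv ℝ (mcY f) z (0, 1) k) / 2,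
        (fderiv ℝ (mcY f) z (1, 0) k - fderiv ℝ (mcX f) z (0, 1) k) / 2⟩ := by
  have dX := differentiableAt_of_smooth hW (contDiffOn_mcX hW hf) hz
  have dY := differentiableAt_of_smooth hW (contDiffOn_mcY hW hf) hz
  have dX' := differentiableAt_pi.1 dX k
  have dY' := differentiableAt_pi.1 dY k
  have eX : ∀ v, fderiv ℝ (fun p => (phi f k p).re) z v = fderiv ℝ (mcX f) z v k / 2 := by
    intro v
    rw [fderiv_coord _ dX]
    change fderiv ℝ (fun p => mcX f p k / 2) z v = _
    simp only [div_eq_mul_inv]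
    rw [fderiv_mul_const dX']
    simp [mul_comm]
  have eY : ∀ v, fderiv ℝ (fun p => (phi f k p).im) z v = fderiv ℝ (mcY f) z v k / 2 := by
    intro v
    rw [fderiv_coord _ dY]
    change fderiv ℝ (fun p => mcY f p k / 2) z v = _
    simp only [div_eq_mul_inv]
    rw [fderiv_mul_const dY']
    simp [mul_comm]
  rw [two_mul_dzbar]
  ext
  · simp only [pd, eX, eY, ip, QuadraticAlgebra.re_sub, QuadraticAlgebra.re_mul]
    ring
  · simp only [pd, eX, eY, ip, QuadraticAlgebra.im_sub, QuadraticAlgebra.im_mul]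
    ring

/-- The Maurer-Cartan equation. -/
theorem maurerCartan (hW : IsOpen W) (hf : ContDiffOn ℝ ∞ f W) (hz : z ∈ W) :
    fderiv ℝ (mcY f) z (1, 0) - fderiv ℝ (mcX f) z (0, 1) = -bracket (mcX f z) (mcY f z) := by
  have dX := differentiableAt_of_smooth hW (contDiffOn_mcX hW hf) hz
  have dY := differentiableAt_of_smooth hW (contDiffOn_mcY hW hf) hz
  have df := differentiableAt_pi.1 (differentiableAt_of_smooth hW hf hz)
  have dfx := differentiableAt_of_smooth hW (contDiffOn_fderiv_apply hW hf (1, 0)) hz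
  have dfy := differentiableAt_of_smooth hW (contDiffOn_fderiv_apply hW hf (0, 1)) hz
  have dfx' := differentiableAt_pi.1 dfx
  have dfy' := differentiableAt_pi.1 dfy
  have hc : ∀ k, fderiv ℝ (fun p => fderiv ℝ f p (0, 1) k) z (1, 0)
      = fderiv ℝ (fun p => fderiv ℝ f p (1, 0) k) z (0, 1) := by
    intro k
    rw [← fderiv_coord _ dfy, ← fderiv_coord _ dfx, fderiv_fderiv_apply_comm hW hf hz]
  have hd := fun k v => fderiv_coord (z := z) f (differentiableAt_of_smooth hW hf hz) v k
  have key : ∀ v w : ℝ × ℝ, (∀ k, DifferentiableAt ℝ (fun p => fderiv ℝ f p v k) z) →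
      fderiv ℝ (fun p => leftPull (f p) (fderiv ℝ f p v) 2) z w
      = fderiv ℝ (fun p => fderiv ℝ f p v 2) z w + (1 / 2) *
        (fderiv ℝ f z w 1 * fderiv ℝ f z v 0 + f z 1 * fderiv ℝ (fun p => fderiv ℝ f p v 0) z w
        - (fderiv ℝ f z w 0 * fderiv ℝ f z v 1
          + f z 0 * fderiv ℝ (fun p => fderiv ℝ f p v 1) z w)) := by
    intro v w hv
    change fderiv ℝ (fun p => fderiv ℝ f p v 2 + (1 / 2) * (f p 1 * fderiv ℝ f p v 0
      - f p 0 * fderiv ℝ f p v 1)) z w = _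
    have d1 := ((df 1).fun_mul (hv 0))
    have d2 := ((df 0).fun_mul (hv 1))
    rw [fderiv_fun_add (hv 2) ((d1.fun_sub d2).const_mul _), fderiv_const_mul (d1.fun_sub d2),
      fderiv_fun_sub d1 d2, fderiv_fun_mul (df 1) (hv 0), fderiv_fun_mul (df 0) (hv 1)]
    simp only [hd, add_apply, smul_apply,
      sub_apply, smul_eq_mul]
    ring
  ext k
  rw [Pi.sub_apply, fderiv_coord _ dX, fderiv_coord _ dY]
  fin_cases k
  · change fderiv ℝ (fun p => fderiv ℝ f p (0, 1) 0) z (1, 0)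
      - fderiv ℝ (fun p => fderiv ℝ f p (1, 0) 0) z (0, 1) = -0
    rw [hc]
    simp
  · change fderiv ℝ (fun p => fderiv ℝ f p (0, 1) 1) z (1, 0)
      - fderiv ℝ (fun p => fderiv ℝ f p (1, 0) 1) z (0, 1) = -0
    rw [hc]
    simp
  · change fderiv ℝ (fun p => leftPull (f p) (fderiv ℝ f p (0, 1)) 2) z (1, 0)
      - fderiv ℝ (fun p => leftPull (f p) (fderiv ℝ f p (1, 0)) 2) z (0, 1)
      = -(fderiv ℝ f z (1, 0) 0 * fderiv ℝ f z (0, 1) 1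
        - fderiv ℝ f z (1, 0) 1 * fderiv ℝ f z (0, 1) 0)
    rw [key _ _ dfx', key _ _ dfy', hc, hc, hc]
    ring

lemma fderiv_lip {X Y : ℝ × ℝ → Vec3} (hX : DifferentiableAt ℝ X z) (hY : DifferentiableAt ℝ Y z)
    (v : ℝ × ℝ) : fderiv ℝ (fun p => lip (X p) (Y p)) z v
      = lip (fderiv ℝ X z v) (Y z) + lip (X z) (fderiv ℝ Y z v) := by
  have hX' := differentiableAt_pi.1 hX
  have hY' := differentiableAt_pi.1 hY
  have d := fun k => (hX' k).fun_mul (hY' k)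
  simp only [lip, fderiv_coord _ hX, fderiv_coord _ hY]
  rw [fderiv_fun_add ((d 0).fun_neg.fun_add (d 1)) (d 2), fderiv_fun_add (d 0).fun_neg (d 1),
    fderiv_fun_neg, fderiv_fun_mul (hX' 0) (hY' 0), fderiv_fun_mul (hX' 1) (hY' 1),
    fderiv_fun_mul (hX' 2) (hY' 2)]
  simp only [add_apply, smul_apply,
      neg_apply, smul_eq_mul]
  ring

/-- The tension field of `f`, left-translated to the Lie algebra. -/
def tension (f : ℝ × ℝ → Vec3) (z : ℝ × ℝ) : Vec3 :=
  fderiv ℝ (mcX f) z (1, 0) + conn (mcX f z) (mcX f z)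
    - (fderiv ℝ (mcY f) z (0, 1) + conn (mcY f z) (mcY f z))

/-- Conformal minimal surfaces are harmonic. -/
theorem tension_eq_zero (hW : IsOpen W) (hf : ContDiffOn ℝ ∞ f W)
    (hE : ∀ p ∈ W, formE f p + formG f p = 0) (hF : ∀ p ∈ W, formF f p = 0)
    (hE0 : formE f z ≠ 0) (hN : IsUnitNormalOn W f N) (hmin : meanCurvature f N z = 0)
    (hz : z ∈ W) : tension f z = 0 := by
  have dX := differentiableAt_of_smooth hW (contDiffOn_mcX hW hf) hz
  have dY := differentiableAt_of_smooth hW (contDiffOn_mcY hW hf) hz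
  have ev := hW.mem_nhds hz
  have hG : formG f z = -formE f z := by linarith [hE z hz]
  -- Tangential part: derivatives of E + G = 0 and F = 0 are combined so that the tension appears,
  -- paired with X or Y, next to Y_x - X_y. The Maurer-Cartan equation replaces the latter by a
  -- bracket, which the connection terms absorb.
  have hEd : ∀ v, lip (fderiv ℝ (mcX f) z v) (mcX f z) + lip (fderiv ℝ (mcY f) z v) (mcY f z)
      = 0 := by
    intro v
    have hl : DifferentiableAt ℝ (fun p => lip (mcX f p) (mcX f p)) z := by
      unfold lip; fun_prop
    have hl' : DifferentiableAt ℝ (fun p => lip (mcY f p) (mcY f p)) z := by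
      unfold lip; fun_prop
    have h0 : fderiv ℝ (fun p => lip (mcX f p) (mcX f p) + lip (mcY f p) (mcY f p)) z v = 0 := by
      have h1 : (fun p => lip (mcX f p) (mcX f p) + lip (mcY f p) (mcY f p))
          =ᶠ[nhds z] fun _ => (0 : ℝ) := Filter.eventually_of_mem ev fun p hp => hE p hp
      rw [h1.fderiv_eq]
      simp
    rw [fderiv_fun_add hl hl', add_apply, fderiv_lip dX dX,
      fderiv_lip dY dY] at h0
    simp only [lip] at h0 ⊢
    linarith
  have hFd : ∀ v, lip (fderiv ℝ (mcX f) z v) (mcY f z) + lip (mcX f z) (fderiv ℝ (mcY f) z v)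
      = 0 := by
    intro v
    have h1 : (fun p => lip (mcX f p) (mcY f p)) =ᶠ[nhds z] fun _ => (0 : ℝ) :=
      Filter.eventually_of_mem ev fun p hp => hF p hp
    rw [← fderiv_lip dX dY, h1.fderiv_eq]
    simp
  have mc := maurerCartan hW hf hz
  obtain ⟨n1, n2, n3⟩ := hN z hz
  have e1 := hEd (1, 0)
  have e2 := hEd (0, 1)
  have f1 := hFd (1, 0)
  have f2 := hFd (0, 1)
  -- Normal part: in conformal coordinates the trace of the second fundamental form is, up to a
  -- nonzero factor, the normal component of the tension.
  have hNT : lip (tension f z) (leftNormal f N z) = 0 := by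
    rw [meanCurvature, hG, hF z hz, div_eq_zero_iff] at hmin
    rcases hmin with h | h
    · have h' : formE f z * (secN f N z - secL f N z) = 0 := by linarith
      have h2 := (mul_eq_zero.1 h').resolve_left hE0
      simp only [tension, secN, secL, lip, Pi.add_apply, Pi.sub_apply] at h2 ⊢
      linarith
    · exact absurd (by nlinarith : formE f z * formE f z = 0) (mul_ne_zero hE0 hE0)
  refine lip_nondegenerate hE0 rfl (hF z hz) hG n1 n2 n3 ?_ ?_ hNT
  · have m0 := congrFun mc 0
    have m1 := congrFun mc 1
    have m2 := congrFun mc 2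
    simp only [tension, lip, conn, bracket, Pi.add_apply, Pi.sub_apply, Pi.neg_apply,
      Matrix.cons_val_zero, Matrix.cons_val_one, Matrix.cons_val] at *
    linear_combination e1 - f2 + mcY f z 0 * m0 - mcY f z 1 * m1 - mcY f z 2 * m2
  · have m0 := congrFun mc 0
    have m1 := congrFun mc 1
    have m2 := congrFun mc 2
    simp only [tension, lip, conn, bracket, Pi.add_apply, Pi.sub_apply, Pi.neg_apply,
      Matrix.cons_val_zero, Matrix.cons_val_one, Matrix.cons_val] at *
    linear_combination -e2 + f1 + mcX f z 0 * m0 - mcX f z 1 * m1 - mcX f z 2 * m2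

lemma meanCurvature_eq_zero (hE : formE f z + formG f z = 0) (hF : formF f z = 0)
    (h : tension f z = 0) : meanCurvature f N z = 0 := by
  have hG : formG f z = -formE f z := by linarith
  have h2 : secL f N z = secN f N z := by
    rw [tension, sub_eq_zero] at h
    rw [secL, secN, h]
  rw [meanCurvature, hG, hF, h2, div_eq_zero_iff]
  left
  ring

/-- The real parts of the three equations are the components of the tension up to a constant. The
imaginary parts are the Maurer-Cartan equation, which holds for every smooth map. -/
theorem harmonicEq_phi_iff (hW : IsOpen W) (hf : ContDiffOn ℝ ∞ f W) (hz : z ∈ W) :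
    HarmonicEq (phi f) z ↔ tension f z = 0 := by
  have mc := maurerCartan hW hf hz
  have m0 := congrFun mc 0
  have m1 := congrFun mc 1
  have m2 := congrFun mc 2
  rw [HarmonicEq, two_mul_dzbar_phi hW hf hz, two_mul_dzbar_phi hW hf hz,
    two_mul_dzbar_phi hW hf hz, funext_iff, Fin.forall_fin_succ, Fin.forall_fin_two]
  simp only [bracket, Pi.sub_apply, Pi.neg_apply,
      Matrix.cons_val_zero, Matrix.cons_val_one, Matrix.cons_val] at m0 m1 m2
  simp only [QuadraticAlgebra.ext_iff, phi, tension, conn, QuadraticAlgebra.re_add,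
    QuadraticAlgebra.im_add, QuadraticAlgebra.re_mul, QuadraticAlgebra.im_mul,
    QuadraticAlgebra.re_sub, QuadraticAlgebra.im_sub, QuadraticAlgebra.re_star,
    QuadraticAlgebra.im_star, Pi.add_apply, Pi.sub_apply, Pi.zero_apply, Fin.succ_zero_eq_one,
    Fin.succ_one_eq_two, Matrix.cons_val_zero, Matrix.cons_val_one, Matrix.cons_val]
  constructor
  · rintro ⟨⟨h0, -⟩, ⟨h1, -⟩, ⟨h2, -⟩⟩
    refine ⟨?_, ?_, ?_⟩
    · linear_combination 2 * h0
    · linear_combination 2 * h1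
    · linear_combination 2 * h2
  · rintro ⟨h0, h1, h2⟩
    refine ⟨⟨?_, ?_⟩, ⟨?_, ?_⟩, ⟨?_, ?_⟩⟩
    · linear_combination h0 / 2
    · linear_combination m0 / 2
    · linear_combination h1 / 2
    · linear_combination m1 / 2
    · linear_combination h2 / 2
    · linear_combination m2 / 2

end Structure

/-! ### Existence and uniqueness of maps with prescribed left-translated derivative -/

section Integration

variable {W : Set (ℝ × ℝ)} {z : ℝ × ℝ}

lemma clm_eq_of_basis {V : Type*} [NormedAddCommGroup V] [NormedSpace ℝ V]
    (L : ℝ × ℝ →L[ℝ] V) (v : ℝ × ℝ) : L v = v.1 • L (1, 0) + v.2 • L (0, 1) := by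
  rw [← map_smul, ← map_smul, ← map_add]
  congr 1
  ext <;> simp

lemma clm_ext_basis {V : Type*} [NormedAddCommGroup V] [NormedSpace ℝ V]
    {L M : ℝ × ℝ →L[ℝ] V} (h1 : L (1, 0) = M (1, 0)) (h2 : L (0, 1) = M (0, 1)) : L = M := by
  refine ContinuousLinearMap.ext fun v => ?_
  rw [clm_eq_of_basis L, clm_eq_of_basis M, h1, h2]

/-- A closed one-form `P dx + Q dy` on a simply connected open set is exact. -/
lemma exists_potential (hW : IsOpen W) (hsc : SimplyConnectedSpace W) {P Q : ℝ × ℝ → ℝ}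
    (hP : ContDiffOn ℝ ∞ P W) (hQ : ContDiffOn ℝ ∞ Q W)
    (h : ∀ z ∈ W, fderiv ℝ Q z (1, 0) = fderiv ℝ P z (0, 1)) :
    ∃ G : ℝ × ℝ → ℝ, ContDiffOn ℝ ∞ G W ∧
      ∀ z ∈ W, fderiv ℝ G z (1, 0) = P z ∧ fderiv ℝ G z (0, 1) = Q z := by
  let η : ℝ × ℝ → (ℝ × ℝ →L[ℝ] ℝ) := fun z =>
    P z • ContinuousLinearMap.fst ℝ ℝ ℝ + Q z • ContinuousLinearMap.snd ℝ ℝ ℝ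
  have hη : ContDiffOn ℝ ∞ η W := (hP.smul contDiffOn_const).add (hQ.smul contDiffOn_const)
  obtain ⟨G, hG⟩ := exists_primitive hW hsc (η := η) (hη.differentiableOn (by simp)) (by
    intro a ha x y
    have dP := differentiableAt_of_smooth hW hP ha
    have dQ := differentiableAt_of_smooth hW hQ ha
    have e : HasFDerivAt η ((fderiv ℝ P a).smulRight (ContinuousLinearMap.fst ℝ ℝ ℝ)
        + (fderiv ℝ Q a).smulRight (ContinuousLinearMap.snd ℝ ℝ ℝ)) a :=
      (dP.hasFDerivAt.smul_const (ContinuousLinearMap.fst ℝ ℝ ℝ)).add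
        (dQ.hasFDerivAt.smul_const (ContinuousLinearMap.snd ℝ ℝ ℝ))
    rw [e.fderiv]
    simp only [add_apply, ContinuousLinearMap.smulRight_apply,
      smul_apply, ContinuousLinearMap.coe_fst', ContinuousLinearMap.coe_snd']
    rw [clm_eq_of_basis (fderiv ℝ P a) x, clm_eq_of_basis (fderiv ℝ P a) y,
      clm_eq_of_basis (fderiv ℝ Q a) x, clm_eq_of_basis (fderiv ℝ Q a) y, h a ha]
    simp only [smul_eq_mul]
    ring)
  refine ⟨G, ?_, fun z hz => ?_⟩
  · rw [contDiffOn_infty_iff_fderiv_of_isOpen hW]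
    exact ⟨fun z hz => (hG z hz).differentiableAt.differentiableWithinAt,
      hη.congr fun z hz => (hG z hz).fderiv⟩
  · rw [(hG z hz).fderiv]
    simp [η]

/-- This is the coefficient of dx ∧ dy in the exterior derivative of Re F dx + Im F dy, so
integrability can be read off from ∂̄F. -/
lemma two_mul_dzbar_im (F : ℝ × ℝ → PC) (z : ℝ × ℝ) : (2 * dzbar F z).im
    = fderiv ℝ (fun p => (F p).im) z (1, 0) - fderiv ℝ (fun p => (F p).re) z (0, 1) := by
  rw [two_mul_dzbar]
  simp [pd, ip]

/-- The equation of minimal surfaces is an integrability condition. -/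
theorem exists_map_of_harmonicEq (hW : IsOpen W) (hsc : SimplyConnectedSpace W)
    {q : Fin 3 → ℝ × ℝ → PC} (hq : ∀ k, SmoothOn (q k) W) (h : ∀ z ∈ W, HarmonicEq q z) :
    ∃ f : ℝ × ℝ → Vec3, ContDiffOn ℝ ∞ f W ∧ ∀ z ∈ W, ∀ k, phi f k z = q k z := by
  have dre := fun k z hz => differentiableAt_of_smooth (z := z) hW (hq k).1 hz
  have dim := fun k z hz => differentiableAt_of_smooth (z := z) hW (hq k).2 hz
  have i0 : ∀ z ∈ W, fderiv ℝ (fun p => (q 0 p).im) z (1, 0)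
      = fderiv ℝ (fun p => (q 0 p).re) z (0, 1) := by
    intro z hz
    rw [← sub_eq_zero, ← two_mul_dzbar_im (q 0) z, (h z hz).1]
    simp
    ring
  have i1 : ∀ z ∈ W, fderiv ℝ (fun p => (q 1 p).im) z (1, 0)
      = fderiv ℝ (fun p => (q 1 p).re) z (0, 1) := by
    intro z hz
    rw [← sub_eq_zero, ← two_mul_dzbar_im (q 1) z, (h z hz).2.1]
    simp
    ring
  have i2 : ∀ z ∈ W, fderiv ℝ (fun p => (q 2 p).im) z (1, 0)
      - fderiv ℝ (fun p => (q 2 p).re) z (0, 1)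
      = 2 * ((q 0 z).im * (q 1 z).re - (q 0 z).re * (q 1 z).im) := by
    intro z hz
    rw [← two_mul_dzbar_im (q 2) z, (h z hz).2.2]
    simp
    ring
  have P0 : ∀ k, (∀ z ∈ W, fderiv ℝ (fun p => (q k p).im) z (1, 0)
      = fderiv ℝ (fun p => (q k p).re) z (0, 1)) → ∃ G : ℝ × ℝ → ℝ, ContDiffOn ℝ ∞ G W ∧
      ∀ z ∈ W, fderiv ℝ G z (1, 0) = 2 * (q k z).re ∧ fderiv ℝ G z (0, 1) = 2 * (q k z).im := by
    intro k hk
    refine exists_potential hW hsc (contDiffOn_const.mul (hq k).1) (contDiffOn_const.mul (hq k).2)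
      fun z hz => ?_
    rw [fderiv_const_mul (dre k z hz), fderiv_const_mul (dim k z hz), smul_apply, smul_apply,
      hk z hz]
  obtain ⟨x, hx, hxd⟩ := P0 0 i0
  obtain ⟨y, hy, hyd⟩ := P0 1 i1
  -- The third coordinate is integrated last: left translation adds (y dx - x dy)/2 to dt, where now
  -- x and y are the first two coordinate functions already found. The corrected form is closed
  -- because of the quadratic term in the third equation.
  obtain ⟨t, ht, htd⟩ := exists_potential hW hsc
    (P := fun z => 2 * (q 2 z).re - (y z * (q 0 z).re - x z * (q 1 z).re))
    (Q := fun z => 2 * (q 2 z).im - (y z * (q 0 z).im - x z * (q 1 z).im))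
    ((contDiffOn_const.mul (hq 2).1).sub ((hy.mul (hq 0).1).sub (hx.mul (hq 1).1)))
    ((contDiffOn_const.mul (hq 2).2).sub ((hy.mul (hq 0).2).sub (hx.mul (hq 1).2))) (by
      intro z hz
      have dx := differentiableAt_of_smooth hW hx hz
      have dy := differentiableAt_of_smooth hW hy hz
      rw [fderiv_fun_sub ((dim 2 z hz).const_mul _)
          ((dy.fun_mul (dim 0 z hz)).fun_sub (dx.fun_mul (dim 1 z hz))),
        fderiv_fun_sub (dy.fun_mul (dim 0 z hz)) (dx.fun_mul (dim 1 z hz)),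
        fderiv_fun_sub ((dre 2 z hz).const_mul _)
          ((dy.fun_mul (dre 0 z hz)).fun_sub (dx.fun_mul (dre 1 z hz))),
        fderiv_fun_sub (dy.fun_mul (dre 0 z hz)) (dx.fun_mul (dre 1 z hz)),
        fderiv_fun_mul dy (dim 0 z hz), fderiv_fun_mul dx (dim 1 z hz),
        fderiv_fun_mul dy (dre 0 z hz), fderiv_fun_mul dx (dre 1 z hz),
        fderiv_const_mul (dim 2 z hz), fderiv_const_mul (dre 2 z hz)]
      simp only [add_apply, sub_apply, smul_apply, smul_eq_mul, (hxd z hz).1, (hxd z hz).2,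
        (hyd z hz).1, (hyd z hz).2]
      linear_combination 2 * i2 z hz - y z * i0 z hz + x z * i1 z hz)
  have hf : ContDiffOn ℝ ∞ (fun z => (![x z, y z, t z] : Vec3)) W := by
    rw [contDiffOn_pi]
    intro i
    fin_cases i
    · exact hx
    · exact hy
    · exact ht
  refine ⟨fun z => ![x z, y z, t z], hf, fun z hz k => ?_⟩
  have hd := fun k v => fderiv_coord (z := z) _ (differentiableAt_of_smooth hW hf hz) v k
  have d0 : ∀ v, fderiv ℝ (fun z => (![x z, y z, t z] : Vec3)) z v 0 = fderiv ℝ x z v := hd 0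
  have d1 : ∀ v, fderiv ℝ (fun z => (![x z, y z, t z] : Vec3)) z v 1 = fderiv ℝ y z v := hd 1
  have d2 : ∀ v, fderiv ℝ (fun z => (![x z, y z, t z] : Vec3)) z v 2 = fderiv ℝ t z v := hd 2
  obtain ⟨x1, x2⟩ := hxd z hz
  obtain ⟨y1, y2⟩ := hyd z hz
  obtain ⟨t1, t2⟩ := htd z hz
  fin_cases k <;> ext <;>
    simp [phi, mcX, mcY, leftPull, d0, d1, d2, x1, x2, y1, y2, t1, t2]
  · ring
  · ring

/-- Two maps with the same left-translated derivative differ by a left translation. -/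
theorem exists_eq_nilMul (hW : IsOpen W) (hc : IsPreconnected W) {f g : ℝ × ℝ → Vec3}
    (hf : ContDiffOn ℝ ∞ f W) (hg : ContDiffOn ℝ ∞ g W)
    (h : ∀ z ∈ W, ∀ k, phi g k z = phi f k z) : ∃ p : Vec3, ∀ z ∈ W, g z = nilMul p (f z) := by
  have df := fun k z hz => differentiableAt_pi.1 (differentiableAt_of_smooth (z := z) hW hf hz) k
  have dg := fun k z hz => differentiableAt_pi.1 (differentiableAt_of_smooth (z := z) hW hg hz) k
  have ef := fun k z hz v => fderiv_coord f (differentiableAt_of_smooth (z := z) hW hf hz) v k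
  have eg := fun k z hz v => fderiv_coord g (differentiableAt_of_smooth (z := z) hW hg hz) v k
  have hX : ∀ z ∈ W, ∀ k, mcX g z k = mcX f z k := fun z hz k => by
    have := congrArg QuadraticAlgebra.re (h z hz k)
    simp only [phi] at this
    linarith
  have hY : ∀ z ∈ W, ∀ k, mcY g z k = mcY f z k := fun z hz k => by
    have := congrArg QuadraticAlgebra.im (h z hz k)
    simp only [phi] at this
    linarith
  obtain ⟨c0, h0⟩ := hW.exists_eq_add_of_fderiv_eq (𝕜 := ℝ) hc
    (f := fun p => g p 0) (g := fun p => f p 0)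
    (fun z hz => (dg 0 z hz).differentiableWithinAt)
    (fun z hz => (df 0 z hz).differentiableWithinAt) (fun z hz => clm_ext_basis
      (by rw [← ef 0 z hz, ← eg 0 z hz]; exact hX z hz 0)
      (by rw [← ef 0 z hz, ← eg 0 z hz]; exact hY z hz 0))
  obtain ⟨c1, h1⟩ := hW.exists_eq_add_of_fderiv_eq (𝕜 := ℝ) hc
    (f := fun p => g p 1) (g := fun p => f p 1)
    (fun z hz => (dg 1 z hz).differentiableWithinAt)
    (fun z hz => (df 1 z hz).differentiableWithinAt) (fun z hz => clm_ext_basis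
      (by rw [← ef 1 z hz, ← eg 1 z hz]; exact hX z hz 1)
      (by rw [← ef 1 z hz, ← eg 1 z hz]; exact hY z hz 1))
  -- The first two coordinates differ by constants c0, c1. The comparison function for the third is
  -- that of the left translate by (c0, c1, 0), from which `g` again differs by a constant.
  have d2 : ∀ z ∈ W, DifferentiableAt ℝ
      (fun p => f p 2 + (1 / 2) * (c0 * f p 1 - f p 0 * c1)) z := fun z hz =>
    (df 2 z hz).fun_add ((((df 1 z hz).const_mul _).fun_sub ((df 0 z hz).mul_const _)).const_mul _)
  have e2 : ∀ z ∈ W, ∀ v, fderiv ℝ (fun p => f p 2 + (1 / 2) * (c0 * f p 1 - f p 0 * c1)) z v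
      = fderiv ℝ f z v 2 + (1 / 2) * (c0 * fderiv ℝ f z v 1 - fderiv ℝ f z v 0 * c1) := by
    intro z hz v
    have a1 := (df 1 z hz).const_mul c0
    have a2 := (df 0 z hz).mul_const c1
    rw [fderiv_fun_add (df 2 z hz) ((a1.fun_sub a2).const_mul _),
      fderiv_const_mul (a1.fun_sub a2), fderiv_fun_sub a1 a2, fderiv_const_mul (df 1 z hz),
      fderiv_mul_const (df 0 z hz), ef 0 z hz, ef 1 z hz, ef 2 z hz]
    simp only [add_apply, sub_apply, smul_apply, smul_eq_mul]
    ring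
  obtain ⟨c2, h2⟩ := hW.exists_eq_add_of_fderiv_eq (𝕜 := ℝ) hc (f := fun p => g p 2)
    (g := fun p => f p 2 + (1 / 2) * (c0 * f p 1 - f p 0 * c1))
    (fun z hz => (dg 2 z hz).differentiableWithinAt)
    (fun z hz => (d2 z hz).differentiableWithinAt) (by
      intro z hz
      have g0 : g z 0 = f z 0 + c0 := h0 hz
      have g1 : g z 1 = f z 1 + c1 := h1 hz
      apply clm_ext_basis
      · rw [e2 z hz, ← eg 2 z hz]
        have x0 : fderiv ℝ g z (1, 0) 0 = fderiv ℝ f z (1, 0) 0 := hX z hz 0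
        have x1 : fderiv ℝ g z (1, 0) 1 = fderiv ℝ f z (1, 0) 1 := hX z hz 1
        have x2 := hX z hz 2
        simp only [mcX, leftPull, Matrix.cons_val, x0, x1, g0, g1] at x2
        linear_combination x2
      · rw [e2 z hz, ← eg 2 z hz]
        have x0 : fderiv ℝ g z (0, 1) 0 = fderiv ℝ f z (0, 1) 0 := hY z hz 0
        have x1 : fderiv ℝ g z (0, 1) 1 = fderiv ℝ f z (0, 1) 1 := hY z hz 1
        have x2 := hY z hz 2
        simp only [mcY, leftPull, Matrix.cons_val, x0, x1, g0, g1] at x2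
        linear_combination x2)
  refine ⟨![c0, c1, c2], fun z hz => ?_⟩
  have g0 : g z 0 = f z 0 + c0 := h0 hz
  have g1 : g z 1 = f z 1 + c1 := h1 hz
  have g2 : g z 2 = f z 2 + (1 / 2) * (c0 * f z 1 - f z 0 * c1) + c2 := h2 hz
  ext i
  fin_cases i
  · simp [nilMul, g0, add_comm]
  · simp [nilMul, g1, add_comm]
  · simp only [nilMul, Fin.reduceFinMk, Matrix.cons_val, Matrix.cons_val_zero, Matrix.cons_val_one,
      g2]
    ring

end Integration

/-! ### Surfaces with conjugate left-translated derivatives -/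

section Conjugate

variable {f g N N' : ℝ × ℝ → Vec3} {c : PC} {z : ℝ × ℝ}

lemma mcX_of_phi (h : ∀ k, phi g k z = c * star (phi f k z)) (k : Fin 3) :
    mcX g z k = c.re * mcX f z k - c.im * mcY f z k := by
  have := congrArg QuadraticAlgebra.re (h k)
  simp [phi] at this
  linarith

lemma mcY_of_phi (h : ∀ k, phi g k z = c * star (phi f k z)) (k : Fin 3) :
    mcY g z k = c.im * mcX f z k - c.re * mcY f z k := by
  have := congrArg QuadraticAlgebra.im (h k)
  simp [phi] at this
  linarith

lemma re_mul_star (c : PC) : (c * star c).re = c.re ^ 2 - c.im ^ 2 := by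
  simp
  ring

/-- For c = p + i'q the new frame is pX - qY, qX - pY. With F = 0 and G = -E its inner products are
those of X, Y multiplied by p² - q² = c c̄. -/
lemma forms_of_phi (h : ∀ k, phi g k z = c * star (phi f k z)) (hF : formF f z = 0)
    (hG : formG f z = -formE f z) :
    formE g z = (c * star c).re * formE f z ∧ formF g z = 0 ∧
      formG g z = -((c * star c).re * formE f z) := by
  have hX := mcX_of_phi h
  have hY := mcY_of_phi h
  rw [re_mul_star]
  simp only [formE, formF, formG, lip] at hF hG ⊢
  simp only [hX, hY]
  refine ⟨?_, ?_, ?_⟩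
  · linear_combination -2 * c.re * c.im * hF + c.im ^ 2 * hG
  · linear_combination (-c.re ^ 2 - c.im ^ 2) * hF + c.re * c.im * hG
  · linear_combination -2 * c.re * c.im * hF + c.re ^ 2 * hG

lemma normal_of_phi (h : ∀ k, phi g k z = c * star (phi f k z)) {n : Vec3}
    (hX : lip n (mcX f z) = 0) (hY : lip n (mcY f z) = 0) :
    lip n (mcX g z) = 0 ∧ lip n (mcY g z) = 0 := by
  have eX := mcX_of_phi h
  have eY := mcY_of_phi h
  simp only [lip] at hX hY ⊢
  simp only [eX, eY]
  constructor
  · linear_combination c.re * hX - c.im * hY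
  · linear_combination c.im * hX - c.re * hY

/-- The passage from X, Y to the new frame has determinant -c c̄, so it is invertible and both
frames span the same plane. -/
lemma normal_of_phi_conj (h : ∀ k, phi g k z = c * star (phi f k z)) (hc : (c * star c).re ≠ 0)
    {n : Vec3} (hX : lip n (mcX g z) = 0) (hY : lip n (mcY g z) = 0) :
    lip n (mcX f z) = 0 ∧ lip n (mcY f z) = 0 := by
  have eX := mcX_of_phi h
  have eY := mcY_of_phi h
  rw [re_mul_star] at hc
  simp only [lip, eX, eY] at hX hY
  constructor
  · refine mul_left_cancel₀ hc ?_
    simp only [lip]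
    linear_combination c.re * hX - c.im * hY
  · refine mul_left_cancel₀ hc ?_
    simp only [lip]
    linear_combination c.im * hX - c.re * hY

/-- The difference m - ⟨m, n⟩n is orthogonal to X, Y and n, hence zero; unit length leaves ⟨m, n⟩ =
±1. -/
lemma normal_eq_or_eq_neg {X Y n m : Vec3} {e : ℝ} (he : e ≠ 0) (hE : lip X X = e)
    (hF : lip X Y = 0) (hG : lip Y Y = -e) (hn : lip n n = 1) (hnX : lip n X = 0)
    (hnY : lip n Y = 0) (hm : lip m m = 1) (hmX : lip m X = 0) (hmY : lip m Y = 0) :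
    m = n ∨ m = -n := by
  have h : m - lip m n • n = 0 := by
    refine lip_nondegenerate he hE hF hG hn hnX hnY ?_ ?_ ?_
    · have : lip (m - lip m n • n) X = lip m X - lip m n * lip n X := by
        simp [lip]
        ring
      rw [this, hmX, hnX]
      ring
    · have : lip (m - lip m n • n) Y = lip m Y - lip m n * lip n Y := by
        simp [lip]
        ring
      rw [this, hmY, hnY]
      ring
    · have : lip (m - lip m n • n) n = lip m n - lip m n * lip n n := by
        simp [lip]
        ring
      rw [this, hn]
      ring
  rw [sub_eq_zero] at h
  generalize lip m n = t at h
  have h2 : t * t * lip n n = 1 := by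
    rw [← hm, h]
    simp [lip]
    ring
  rw [hn, mul_one, mul_self_eq_one_iff] at h2
  rcases h2 with rfl | rfl
  · left
    rw [h, one_smul]
  · right
    rw [h, neg_one_smul]

lemma leftPull_eq_smul_add (p : Vec3) (L : ℝ × ℝ →L[ℝ] Vec3) (v : ℝ × ℝ) :
    leftPull p (L v) = v.1 • leftPull p (L (1, 0)) + v.2 • leftPull p (L (0, 1)) := by
  rw [clm_eq_of_basis L v]
  ext i
  fin_cases i <;> simp [leftPull]
  ring

lemma injective_fderiv_of_forms (hE : formE f z ≠ 0) (hF : formF f z = 0) (hG : formG f z ≠ 0) :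
    Function.Injective (fderiv ℝ f z) := by
  rw [injective_iff_map_eq_zero]
  intro v hv
  have h0 : v.1 • mcX f z + v.2 • mcY f z = 0 := by
    have := leftPull_eq_smul_add (f z) (fderiv ℝ f z) v
    rw [hv] at this
    rw [mcX, mcY, ← this]
    ext i
    fin_cases i <;> simp [leftPull]
  have h1 : v.1 * formE f z + v.2 * formF f z = 0 := by
    have : lip (v.1 • mcX f z + v.2 • mcY f z) (mcX f z) = 0 := by
      rw [h0]
      simp [lip]
    rw [← this]
    simp [formE, formF, lip]
    ring
  have h2 : v.1 * formF f z + v.2 * formG f z = 0 := by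
    have : lip (v.1 • mcX f z + v.2 • mcY f z) (mcY f z) = 0 := by
      rw [h0]
      simp [lip]
    rw [← this]
    simp [formG, formF, lip]
    ring
  rw [hF, mul_zero, add_zero] at h1
  rw [hF, mul_zero, zero_add] at h2
  ext
  · exact (mul_eq_zero.1 h1).resolve_right hE
  · exact (mul_eq_zero.1 h2).resolve_right hG

lemma isNonverticalAt_of_normal {n : Vec3} (hX : lip n (mcX f z) = 0) (hY : lip n (mcY f z) = 0)
    (hn : n 2 ≠ 0) : IsNonverticalAt f z := by
  intro h
  rw [Submodule.mem_span_pair] at h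
  obtain ⟨s, t, h⟩ := h
  apply hn
  have h1 : lip n ![0, 0, 1] = s * lip n (mcX f z) + t * lip n (mcY f z) := by
    rw [← h]
    simp [lip]
    ring
  rw [hX, hY] at h1
  simp [lip] at h1
  exact h1

/-- The vector at `p` with left translation `v` to the identity. -/
def leftPush (p v : Vec3) : Vec3 := ![v 0, v 1, v 2 - (1 / 2) * (p 1 * v 0 - p 0 * v 1)]

lemma leftPull_leftPush (p v : Vec3) : leftPull p (leftPush p v) = v := by
  ext i
  fin_cases i <;> simp [leftPull, leftPush]

end Conjugate

/-! ### Square roots and dual spinors -/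

lemma IsSignUnit.mul_self {e : PC} (h : IsSignUnit e) : e * e = 1 := by
  rcases h with rfl | rfl | rfl | rfl
  · exact one_mul 1
  · rw [neg_mul_neg, one_mul]
  · exact ip_mul_ip
  · rw [neg_mul_neg, ip_mul_ip]

lemma nonneg_of_isSquare {w : PC} (hw : IsSquare w) : 0 ≤ w.re + w.im ∧ 0 ≤ w.re - w.im := by
  obtain ⟨r, rfl⟩ := hw
  have h1 : (r * r).re + (r * r).im = (r.re + r.im) ^ 2 := by simp; ring
  have h2 : (r * r).re - (r * r).im = (r.re - r.im) ^ 2 := by simp; ring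
  rw [h1, h2]
  exact ⟨sq_nonneg _, sq_nonneg _⟩

/-- In the components x + y and x - y the four units are the four choices of signs. If `e * b` is a
square, its components are nonnegative and so are the absolute values of those of `b`. -/
lemma isSignUnit_mul_eq_abs {e b : PC} (he : IsSignUnit e) (h : IsSquare (e * b)) :
    (e * b).re + (e * b).im = √((b.re + b.im) ^ 2) ∧
      (e * b).re - (e * b).im = √((b.re - b.im) ^ 2) := by
  obtain ⟨h1, h2⟩ := nonneg_of_isSquare h
  rw [← Real.sqrt_sq h1, ← Real.sqrt_sq h2]
  rcases he with rfl | rfl | rfl | rfl <;>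
    simp [ip] <;> constructor <;> congr 1 <;> ring

lemma star_psqrt (w : PC) : star (psqrt w) = psqrt (star w) := by
  ext
  · simp [psqrt, add_comm, sub_eq_add_neg]
  · simp [psqrt, add_comm, sub_eq_add_neg]
    ring

lemma psqrt_mul_psqrt_star {w : PC} (hw : IsSquare w) :
    psqrt w * star (psqrt w) = algebraMap ℝ PC (√(w * star w).re) := by
  obtain ⟨h1, h2⟩ := nonneg_of_isSquare hw
  have h3 : √(w * star w).re = √(w.re + w.im) * √(w.re - w.im) := by
    rw [re_mul_star, ← Real.sqrt_mul h1]
    congr 1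
    ring
  rw [h3]
  ext
  · simp [psqrt]
    ring
  · simp [psqrt]
    ring

lemma mul_star_eq_algebraMap (x : PC) : x * star x = algebraMap ℝ PC (x * star x).re := by
  ext
  · simp
  · simp
    ring

lemma re_mul_star_ne_zero {x : PC} (h : x * star x ≠ 0) : (x * star x).re ≠ 0 := by
  intro h0
  apply h
  rw [mul_star_eq_algebraMap, h0, map_zero]

section Root

variable {W : Set (ℝ × ℝ)} {ε B : ℝ × ℝ → PC} {z : ℝ × ℝ}

/-- No continuity of `ε` is needed: by `isSignUnit_mul_eq_abs` the root depends on `B` alone,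
through the components √|x ± y|. These are smooth where x ± y ≠ 0, that is, where B B̄ ≠ 0. -/
lemma smoothOn_psqrt (hB : SmoothOn B W) (h0 : ∀ z ∈ W, B z * star (B z) ≠ 0)
    (hε : ∀ z ∈ W, IsSignUnit (ε z) ∧ IsSquare (ε z * B z)) :
    SmoothOn (fun z => psqrt (ε z * B z)) W := by
  have hne : ∀ z ∈ W, (B z).re + (B z).im ≠ 0 ∧ (B z).re - (B z).im ≠ 0 := by
    intro z hz
    have h := re_mul_star_ne_zero (h0 z hz)
    rw [re_mul_star, sq_sub_sq] at h
    exact mul_ne_zero_iff.1 h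
  have c1 : ContDiffOn ℝ ∞ (fun z => √(√(((B z).re + (B z).im) ^ 2))) W :=
    (((hB.1.add hB.2).pow 2).sqrt fun z hz => pow_ne_zero 2 (hne z hz).1).sqrt fun z hz =>
      (Real.sqrt_pos.2 (by have := (hne z hz).1; positivity)).ne'
  have c2 : ContDiffOn ℝ ∞ (fun z => √(√(((B z).re - (B z).im) ^ 2))) W :=
    (((hB.1.sub hB.2).pow 2).sqrt fun z hz => pow_ne_zero 2 (hne z hz).2).sqrt fun z hz =>
      (Real.sqrt_pos.2 (by have := (hne z hz).2; positivity)).ne'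
  refine ⟨((c1.add c2).div_const 2).congr fun z hz => ?_,
    ((c1.sub c2).div_const 2).congr fun z hz => ?_⟩
  · obtain ⟨e1, e2⟩ := isSignUnit_mul_eq_abs (hε z hz).1 (hε z hz).2
    simp only [psqrt, e1, e2]
  · obtain ⟨e1, e2⟩ := isSignUnit_mul_eq_abs (hε z hz).1 (hε z hz).2
    simp only [psqrt, e1, e2]

lemma rootBB_eq (ε B : ℝ × ℝ → PC) (z : ℝ × ℝ) :
    rootBB ε B z = √(ε z * B z * star (ε z * B z)).re := by
  rw [rootBB, star_mul']
  congr 2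
  ring

lemma psqrt_mul_star_eq_rootBB (hε : IsSquare (ε z * B z)) :
    psqrt (ε z * B z) * star (psqrt (ε z * B z)) = algebraMap ℝ PC (rootBB ε B z) := by
  rw [psqrt_mul_psqrt_star hε, rootBB_eq]

lemma re_mul_star_pos (h0 : B z * star (B z) ≠ 0) (hε : IsSignUnit (ε z))
    (hs : IsSquare (ε z * B z)) : 0 < (ε z * B z * star (ε z * B z)).re := by
  obtain ⟨h1, h2⟩ := nonneg_of_isSquare hs
  refine lt_of_le_of_ne ?_ (Ne.symm (re_mul_star_ne_zero ?_))
  · rw [re_mul_star, sq_sub_sq]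
    exact mul_nonneg h1 h2
  · intro h
    apply h0
    have e1 := hε.mul_self
    have e2 := congrArg star e1
    rw [star_mul', star_one] at e2
    rw [star_mul'] at h
    linear_combination ε z * star (ε z) * h - B z * star (B z) * e1
      - B z * star (B z) * ε z * ε z * e2

lemma rootBB_pos (h0 : B z * star (B z) ≠ 0) (hε : IsSignUnit (ε z))
    (hs : IsSquare (ε z * B z)) : 0 < rootBB ε B z := by
  rw [rootBB_eq]
  exact Real.sqrt_pos.2 (re_mul_star_pos h0 hε hs)

/-- The fourth power of the root is (εB)² = B², which no longer contains `ε`. Hence 4r³∂̄r = ∂̄(B²)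
= 0, and r is invertible because r r̄ is a positive real. -/
lemma dzbar_psqrt (hW : IsOpen W) (hB : SmoothOn B W) (h0 : ∀ z ∈ W, B z * star (B z) ≠ 0)
    (hε : ∀ z ∈ W, IsSignUnit (ε z) ∧ IsSquare (ε z * B z)) (hB0 : dzbar B z = 0) (hz : z ∈ W) :
    dzbar (fun z => psqrt (ε z * B z)) z = 0 := by
  have dr := (smoothOn_psqrt hB h0 hε).diffAt hW hz
  have dB := hB.diffAt hW hz
  have drr := dr.mul dr
  have h1 : dzbar (fun z => (psqrt (ε z * B z) * psqrt (ε z * B z)) *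
      (psqrt (ε z * B z) * psqrt (ε z * B z))) z = 0 := by
    rw [dzbar_congr (G := fun p => B p * B p) (Filter.eventually_of_mem (hW.mem_nhds hz)
      fun p hp => ?_), dzbar_mul_self dB, hB0, mul_zero, mul_zero]
    simp only [psqrt_mul_self (hε p hp).2]
    linear_combination B p * B p * (hε p hp).1.mul_self
  rw [dzbar_mul_self drr, dzbar_mul_self dr] at h1
  have h2 := psqrt_mul_star_eq_rootBB (hε z hz).2
  have h3 : algebraMap ℝ PC (rootBB ε B z) * algebraMap ℝ PC (rootBB ε B z)⁻¹ = 1 := by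
    rw [← map_mul, mul_inv_cancel₀ (rootBB_pos (h0 z hz) (hε z hz).1 (hε z hz).2).ne', map_one]
  rw [← h2] at h3
  generalize psqrt (ε z * B z) = r at *
  generalize dzbar (fun z => psqrt (ε z * B z)) z = d at *
  generalize algebraMap ℝ PC (rootBB ε B z)⁻¹ = s at *
  refine mul_left_cancel_ofNat (n := 4) ?_
  have h4 : r * (star r * s) = 1 := by rw [← mul_assoc, h3]
  generalize star r * s = t at h4
  have h5 : (r * t) ^ 3 = 1 := by rw [h4, one_pow]
  linear_combination t ^ 3 * h1 - 4 * d * h5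

end Root

/-- For H = 0 the quartic term of the Hopf coefficient, multiplied by -i', is 4(ψ₁ψ̄₂)² and cancels
φ₃². Only the wronskian survives. -/
lemma two_mul_arCoeff (κ ψ₁ ψ₂ : ℝ × ℝ → PC) (z : ℝ × ℝ) :
    2 * arCoeff 0 κ ψ₁ ψ₂ z = -(ip * (κ z * wronskian ψ₁ (fun p => star (ψ₂ p)) z)) := by
  have h4 : 4 * arCoeff 0 κ ψ₁ ψ₂ z
      = -ip * hopf κ ψ₁ ψ₂ z - (2 * (ψ₁ z * star (ψ₂ z))) ^ 2 := by
    have e1 : (⟨2 * 0, -1⟩ : PC) = -ip := by ext <;> simp [ip]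
    rw [arCoeff, e1, mul_smul_comm, ← smul_mul_assoc]
    have : ((1 / 4 : ℝ) • (4 : PC)) = 1 := by
      ext <;> simp [QuadraticAlgebra.re_ofNat, QuadraticAlgebra.im_ofNat, QuadraticAlgebra.re_one,
        QuadraticAlgebra.im_one]
    rw [this, one_mul]
  refine mul_left_cancel_ofNat (n := 2) ?_
  rw [hopf] at h4
  rw [wronskian]
  linear_combination h4 + 4 * (ψ₁ z * star (ψ₂ z)) ^ 2 * ip_mul_ip

section DualSpinors

variable {a b : ℝ × ℝ → PC} {z : ℝ × ℝ}

/-- The wronskian of `c b̄` and `c ā`. -/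
lemma wronskian_dual {c : ℝ × ℝ → PC} (ha : DiffAt a z) (hb : DiffAt b z) (hc : DiffAt c z)
    (h : DiracEq a b z) :
    8 * wronskian (fun p => c p * star (b p)) (fun p => c p * star (a p)) z
      = -(ip * (c z * c z * (supp a b z * supp a b z))) := by
  obtain ⟨h1, h2⟩ := h.conj
  have hs : supp a b z = 2 * (b z * star (b z) - a z * star (a z)) := rfl
  rw [wronskian, dz_mul hc ha.star, dz_mul hc hb.star, dz_star, dz_star]
  linear_combination 2 * c z * c z * (star (b z) * h1 - star (a z) * h2)
    + ip * c z * c z * supp a b z * hs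

end DualSpinors

lemma HarmonicEq.congr {W : Set (ℝ × ℝ)} (hW : IsOpen W) {q p : Fin 3 → ℝ × ℝ → PC} {z : ℝ × ℝ}
    (hz : z ∈ W) (h : ∀ z ∈ W, ∀ k, p k z = q k z) (hq : HarmonicEq q z) : HarmonicEq p z := by
  have e : ∀ k, dzbar (p k) z = dzbar (q k) z := fun k =>
    dzbar_congr (Filter.eventually_of_mem (hW.mem_nhds hz) fun x hx => h x hx k)
  rw [HarmonicEq, e, e, e, h z hz, h z hz, h z hz]
  exact hq

/-! ### The dual of a minimal surface, in terms of spinors -/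

/-- The spinors `ψ₁, ψ₂` of a minimal surface over `D` with positive support function `h`,
Abresch-Rosenberg coefficient `B`, and units `ε` such that `ε B` is a square. -/
structure IsMinimalSpinor (D : Set (ℝ × ℝ)) (ψ₁ ψ₂ : ℝ × ℝ → PC) (h : ℝ × ℝ → ℝ)
    (B ε : ℝ × ℝ → PC) : Prop where
  isOpen : IsOpen D
  smooth₁ : SmoothOn ψ₁ D
  smooth₂ : SmoothOn ψ₂ D
  dirac : ∀ z ∈ D, DiracEq ψ₁ (fun p => star (ψ₂ p)) z
  supp_eq : ∀ z, supp ψ₁ (fun p => star (ψ₂ p)) z = algebraMap ℝ PC (h z)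
  pos : ∀ z ∈ D, 0 < h z
  coeff : ∀ z, 2 * B z = -(ip * wronskian ψ₁ (fun p => star (ψ₂ p)) z)
  sign : ∀ z ∈ D, IsSignUnit (ε z)
  square : ∀ z ∈ D, IsSquare (ε z * B z)

/-- The inverse of a real function with values in the para-complex numbers. -/
def invC (h : ℝ × ℝ → ℝ) (z : ℝ × ℝ) : PC := algebraMap ℝ PC (h z)⁻¹

namespace IsMinimalSpinor

variable {D : Set (ℝ × ℝ)} {ψ₁ ψ₂ B ε : ℝ × ℝ → PC} {h : ℝ × ℝ → ℝ} {z : ℝ × ℝ} {σ : PC}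

lemma invC_mul (S : IsMinimalSpinor D ψ₁ ψ₂ h B ε) (hz : z ∈ D) :
    invC h z * supp ψ₁ (fun p => star (ψ₂ p)) z = 1 := by
  rw [S.supp_eq, invC, ← map_mul, inv_mul_cancel₀ (S.pos z hz).ne', map_one]

lemma star_invC (h : ℝ × ℝ → ℝ) (z : ℝ × ℝ) : star (invC h z) = invC h z := star_ofReal _

lemma smoothOn_invC (S : IsMinimalSpinor D ψ₁ ψ₂ h B ε) : SmoothOn (invC h) D := by
  have hs : SmoothOn (supp ψ₁ (fun p => star (ψ₂ p))) D :=
    (SmoothOn.const 2).mul ((S.smooth₂.star.mul S.smooth₂.star.star).sub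
      (S.smooth₁.mul S.smooth₁.star))
  have hh : ContDiffOn ℝ ∞ h D := hs.1.congr fun z _ => by
    rw [S.supp_eq]
    rfl
  exact ⟨hh.inv fun z hz => (S.pos z hz).ne', contDiffOn_const (c := (0 : ℝ))⟩

lemma coeff_eq (S : IsMinimalSpinor D ψ₁ ψ₂ h B ε) :
    B = fun z => algebraMap ℝ PC (1 / 2) * (-ip * wronskian ψ₁ (fun p => star (ψ₂ p)) z) := by
  funext z
  have e : algebraMap ℝ PC (1 / 2) * 2 = 1 := by
    have : (2 : PC) = algebraMap ℝ PC 2 := rfl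
    rw [this, ← map_mul]
    norm_num
  linear_combination algebraMap ℝ PC (1 / 2) * S.coeff z - B z * e

lemma smoothOn_wronskian (S : IsMinimalSpinor D ψ₁ ψ₂ h B ε) :
    SmoothOn (wronskian ψ₁ (fun p => star (ψ₂ p))) D :=
  (S.smooth₁.mul (S.smooth₂.star.dz S.isOpen)).sub (S.smooth₂.star.mul (S.smooth₁.dz S.isOpen))

lemma smoothOn_coeff (S : IsMinimalSpinor D ψ₁ ψ₂ h B ε) : SmoothOn B D := by
  rw [S.coeff_eq]
  exact (SmoothOn.const _).mul ((SmoothOn.const _).mul S.smoothOn_wronskian)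

lemma dzbar_coeff (S : IsMinimalSpinor D ψ₁ ψ₂ h B ε) (hz : z ∈ D) : dzbar B z = 0 := by
  have dw := S.smoothOn_wronskian.diffAt S.isOpen hz
  rw [S.coeff_eq, dzbar_const_mul _ ((DiffAt.const _).mul dw), dzbar_const_mul _ dw,
    dzbar_wronskian S.isOpen S.smooth₁ S.smooth₂.star S.dirac hz, mul_zero, mul_zero]

lemma dualSpinor₁_eq (ε B : ℝ × ℝ → PC) (h : ℝ × ℝ → ℝ) (ψ₂ : ℝ × ℝ → PC) :
    dualSpinor₁ ε B h ψ₂ = fun z =>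
      4 * (psqrt (ε z * B z) * (invC h z * star (star (ψ₂ z)))) := by
  funext z
  have : (4 : PC) = algebraMap ℝ PC 4 := rfl
  rw [dualSpinor₁, Algebra.smul_def, div_eq_mul_inv, map_mul, star_star, invC, this]
  ring

lemma dualSpinor₂_eq (ε B : ℝ × ℝ → PC) (h : ℝ × ℝ → ℝ) (ψ₁ : ℝ × ℝ → PC) :
    dualSpinor₂ ε B h ψ₁ = fun z =>
      4 * (star (psqrt (ε z * B z)) * (invC h z * ψ₁ z)) := by
  funext z
  have : (4 : PC) = algebraMap ℝ PC 4 := rfl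
  rw [dualSpinor₂, Algebra.smul_def, div_eq_mul_inv, map_mul, invC, this, star_psqrt, star_mul']
  ring

lemma star_dualSpinor₂ (ε B : ℝ × ℝ → PC) (h : ℝ × ℝ → ℝ) (ψ₁ : ℝ × ℝ → PC) (z : ℝ × ℝ) :
    star (dualSpinor₂ ε B h ψ₁ z) = 4 * (psqrt (ε z * B z) * (invC h z * star (ψ₁ z))) := by
  have h4 : star (4 : PC) = 4 := by ext <;> simp
  rw [dualSpinor₂_eq, star_mul', h4, star_mul', star_star, star_mul', star_invC]

/-- The one-form is quadratic in the spinors, so the root occurs only through its square εB, and the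
outer factor ε turns this into B. The right-hand side contains neither root nor unit, and is smooth
even where the dual spinors need not be. -/
lemma isGeneratedOn_iff (S : IsMinimalSpinor D ψ₁ ψ₂ h B ε) (hσ : σ = ip ∨ σ = -ip)
    {g : ℝ × ℝ → Vec3} {W : Set (ℝ × ℝ)} (hW : W ⊆ D) :
    IsGeneratedOn W ε (-σ) (dualSpinor₁ ε B h ψ₂) (dualSpinor₂ ε B h ψ₁) g ↔
      ∀ z ∈ W, ∀ k, phi g k z = dualForm σ ψ₁ (fun p => star (ψ₂ p)) (invC h) B k z := by
  refine forall₂_congr fun z hz => ?_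
  have hr := psqrt_mul_self (S.square z (hW hz))
  have he := (S.sign z (hW hz)).mul_self
  have e0 : ε z * (-σ * (star (dualSpinor₂ ε B h ψ₁ z) ^ 2 + dualSpinor₁ ε B h ψ₂ z ^ 2))
      = dualForm σ ψ₁ (fun p => star (ψ₂ p)) (invC h) B 0 z := by
    rw [star_dualSpinor₂, dualSpinor₁_eq]
    simp only [dualForm, spinForm, Matrix.cons_val_zero, star_mul', star_add, star_sign hσ,
      star_star]
    generalize psqrt (ε z * B z) = r at *
    linear_combination -16 * σ * invC h z * invC h z * (star (ψ₁ z) ^ 2 + ψ₂ z ^ 2)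
      * (ε z * hr + B z * he)
  have e1 : ε z * (-σ * ip * (star (dualSpinor₂ ε B h ψ₁ z) ^ 2 - dualSpinor₁ ε B h ψ₂ z ^ 2))
      = dualForm σ ψ₁ (fun p => star (ψ₂ p)) (invC h) B 1 z := by
    rw [star_dualSpinor₂, dualSpinor₁_eq]
    simp only [dualForm, spinForm, Matrix.cons_val_one, Matrix.cons_val_zero, star_mul', star_sub,
      star_sign hσ, star_ip, star_star]
    generalize psqrt (ε z * B z) = r at *
    linear_combination -16 * σ * ip * invC h z * invC h z * (star (ψ₁ z) ^ 2 - ψ₂ z ^ 2)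
      * (ε z * hr + B z * he)
  have e2 : ε z * (2 * (dualSpinor₁ ε B h ψ₂ z * star (dualSpinor₂ ε B h ψ₁ z)))
      = dualForm σ ψ₁ (fun p => star (ψ₂ p)) (invC h) B 2 z := by
    rw [star_dualSpinor₂, dualSpinor₁_eq]
    simp only [dualForm, spinForm, Matrix.cons_val, star_mul', star_two, star_star]
    generalize psqrt (ε z * B z) = r at *
    linear_combination 32 * invC h z * invC h z * (star (ψ₁ z) * ψ₂ z)
      * (ε z * hr + B z * he)
  rw [e0, e1, e2, Fin.forall_fin_succ, Fin.forall_fin_two]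
  rfl

lemma smoothOn_dualForm (S : IsMinimalSpinor D ψ₁ ψ₂ h B ε) (k : Fin 3) :
    SmoothOn (dualForm σ ψ₁ (fun p => star (ψ₂ p)) (invC h) B k) D := by
  have h1 := S.smooth₁
  have h2 := S.smooth₂.star
  have hs : SmoothOn (spinForm σ ψ₁ (fun p => star (ψ₂ p)) k) D := by
    fin_cases k
    · exact (SmoothOn.const σ).mul ((h2.mul h2).add (h1.mul h1))
    · exact (SmoothOn.const (σ * ip)).mul ((h2.mul h2).sub (h1.mul h1))
    · exact (SmoothOn.const 2).mul (h1.mul h2)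
  exact ((SmoothOn.const 16).mul (S.smoothOn_coeff.mul (S.smoothOn_invC.mul S.smoothOn_invC))).mul
    hs.star

lemma harmonicEq_dual (S : IsMinimalSpinor D ψ₁ ψ₂ h B ε) (hσ : σ = ip ∨ σ = -ip) (hz : z ∈ D) :
    HarmonicEq (dualForm σ ψ₁ (fun p => star (ψ₂ p)) (invC h) B) z :=
  harmonicEq_dualForm hσ (S.smooth₁.diffAt S.isOpen hz) (S.smooth₂.star.diffAt S.isOpen hz)
    (S.smoothOn_invC.diffAt S.isOpen hz) (S.smoothOn_coeff.diffAt S.isOpen hz) (S.dirac z hz)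
    (Filter.eventually_of_mem (S.isOpen.mem_nhds hz) fun _ hp => S.invC_mul hp)
    (star_invC h z) (S.coeff z) (S.dzbar_coeff hz)

/-- Existence of the dual surface. -/
theorem exists_dual (S : IsMinimalSpinor D ψ₁ ψ₂ h B ε) (hσ : σ = ip ∨ σ = -ip)
    (hsc : SimplyConnectedSpace D) :
    ∃ g : ℝ × ℝ → Vec3, ContDiffOn ℝ ∞ g D ∧
      IsGeneratedOn D ε (-σ) (dualSpinor₁ ε B h ψ₂) (dualSpinor₂ ε B h ψ₁) g := by
  obtain ⟨g, hg, hq⟩ := exists_map_of_harmonicEq S.isOpen hsc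
    (fun k => S.smoothOn_dualForm (σ := σ) k) (fun z hz => S.harmonicEq_dual hσ hz)
  exact ⟨g, hg, (S.isGeneratedOn_iff hσ subset_rfl).2 hq⟩

lemma isOpen_regular (S : IsMinimalSpinor D ψ₁ ψ₂ h B ε) :
    IsOpen {z | z ∈ D ∧ B z * star (B z) ≠ 0} := by
  have hB := S.smoothOn_coeff
  have hc : ContinuousOn (fun z => (B z * star (B z)).re) D :=
    (hB.mul hB.star).1.continuousOn
  have := hc.isOpen_inter_preimage S.isOpen (isOpen_compl_singleton (x := (0 : ℝ)))
  convert this using 1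
  ext z
  refine and_congr_right fun _ => ⟨re_mul_star_ne_zero, fun h0 h1 => h0 ?_⟩
  simp [h1]

/-- Restriction to the set where `B B̄ ≠ 0`. -/
lemma regular (S : IsMinimalSpinor D ψ₁ ψ₂ h B ε) :
    IsMinimalSpinor {z | z ∈ D ∧ B z * star (B z) ≠ 0} ψ₁ ψ₂ h B ε where
  isOpen := S.isOpen_regular
  smooth₁ := S.smooth₁.mono fun _ hz => hz.1
  smooth₂ := S.smooth₂.mono fun _ hz => hz.1
  dirac z hz := S.dirac z hz.1
  supp_eq := S.supp_eq
  pos z hz := S.pos z hz.1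
  coeff := S.coeff
  sign z hz := S.sign z hz.1
  square z hz := S.square z hz.1

section Regular

variable (S : IsMinimalSpinor D ψ₁ ψ₂ h B ε) (h0 : ∀ z ∈ D, B z * star (B z) ≠ 0)

include S h0

lemma smoothOn_root : SmoothOn (fun z => psqrt (ε z * B z)) D :=
  smoothOn_psqrt S.smoothOn_coeff h0 fun z hz => ⟨S.sign z hz, S.square z hz⟩

lemma dzbar_root (hz : z ∈ D) : dzbar (fun z => psqrt (ε z * B z)) z = 0 :=
  dzbar_psqrt S.isOpen S.smoothOn_coeff h0 (fun z hz => ⟨S.sign z hz, S.square z hz⟩)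
    (S.dzbar_coeff hz) hz

end Regular

end IsMinimalSpinor

/-- Both ψ₁ and ψ̄₂ acquire the factor i', because conj(-i'ψ₂) = i'ψ̄₂, and the generating formulas
are quadratic with (i')² = 1. -/
lemma isGeneratedOn_ip_mul {W : Set (ℝ × ℝ)} {κ ψ₁ ψ₂ : ℝ × ℝ → PC} {σ : PC} {f : ℝ × ℝ → Vec3}
    (h : IsGeneratedOn W κ σ ψ₁ ψ₂ f) :
    IsGeneratedOn W κ σ (fun z => ip * ψ₁ z) (fun z => -(ip * ψ₂ z)) f := by
  intro z hz
  obtain ⟨h0, h1, h2⟩ := h z hz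
  rw [h0, h1, h2]
  simp only [star_neg, star_mul', star_ip]
  have i2 := ip_mul_ip
  refine ⟨?_, ?_, ?_⟩
  · linear_combination -κ z * σ * (star (ψ₂ z) ^ 2 + ψ₁ z ^ 2) * i2
  · linear_combination -κ z * σ * ip * (star (ψ₂ z) ^ 2 - ψ₁ z ^ 2) * i2
  · linear_combination -2 * κ z * ψ₁ z * star (ψ₂ z) * i2

lemma isDiracPotentialOn_ip_mul {W : Set (ℝ × ℝ)} {κ U ψ₁ ψ₂ : ℝ × ℝ → PC}
    (hW : IsOpen W) (h1 : SmoothOn ψ₁ W) (h2 : SmoothOn ψ₂ W)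
    (h : IsDiracPotentialOn W κ (fun z => -U z) ψ₁ ψ₂) :
    IsDiracPotentialOn W κ U (fun z => ip * ψ₁ z) (fun z => -(ip * ψ₂ z)) := by
  intro z hz
  obtain ⟨e1, e2⟩ := h z hz
  have hn : (fun z => -(ip * ψ₂ z)) = fun z => -ip * ψ₂ z := by
    funext p
    ring
  rw [hn, dz_const_mul _ (h2.diffAt hW hz), dzbar_const_mul _ (h1.diffAt hW hz)]
  constructor
  · linear_combination -ip * e1
  · linear_combination ip * e2

namespace IsMinimalSpinor

variable {D : Set (ℝ × ℝ)} {ψ₁ ψ₂ B ε : ℝ × ℝ → PC} {h : ℝ × ℝ → ℝ} {z : ℝ × ℝ} {σ : PC}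

lemma root_mul_star (S : IsMinimalSpinor D ψ₁ ψ₂ h B ε) (hz : z ∈ D) :
    psqrt (ε z * B z) * star (psqrt (ε z * B z)) = algebraMap ℝ PC (rootBB ε B z) :=
  psqrt_mul_star_eq_rootBB (S.square z hz)

/-- Exchanging the roles of ψ₁ and ψ₂ reverses the sign of the support expression, and i'·conj(i') =
-1 reverses it once more. The factor i' thus makes the support function positive where B B̄ ≠ 0. -/
lemma spinorSupport_dual (S : IsMinimalSpinor D ψ₁ ψ₂ h B ε) (hz : z ∈ D) :
    spinorSupport (fun z => ip * dualSpinor₁ ε B h ψ₂ z)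
      (fun z => -(ip * dualSpinor₂ ε B h ψ₁ z)) z = 16 * rootBB ε B z / h z := by
  have h4 : star (4 : PC) = 4 := by ext <;> simp
  have e : 2 * (-(ip * dualSpinor₂ ε B h ψ₁ z) * star (-(ip * dualSpinor₂ ε B h ψ₁ z))
      - ip * dualSpinor₁ ε B h ψ₂ z * star (ip * dualSpinor₁ ε B h ψ₂ z))
      = algebraMap ℝ PC (16 * rootBB ε B z / h z) := by
    have h1 : algebraMap ℝ PC (16 * rootBB ε B z / h z)
        = 16 * (psqrt (ε z * B z) * star (psqrt (ε z * B z))) * invC h z := by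
      rw [S.root_mul_star hz, div_eq_mul_inv, map_mul, map_mul, invC]
      rfl
    have h2 : invC h z * (2 * (star (ψ₂ z) * star (star (ψ₂ z)) - ψ₁ z * star (ψ₁ z))) = 1 :=
      S.invC_mul hz
    rw [h1]
    simp only [star_neg, star_mul', star_ip, star_dualSpinor₂]
    rw [dualSpinor₁_eq, dualSpinor₂_eq]
    simp only [star_mul', star_star, star_invC, h4] at h2 ⊢
    generalize psqrt (ε z * B z) = r at *
    linear_combination 16 * r * star r * invC h z * h2
      + 32 * r * star r * invC h z ^ 2 * (ψ₂ z * star (ψ₂ z) - ψ₁ z * star (ψ₁ z)) * ip_mul_ip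
  have := congrArg QuadraticAlgebra.re e
  rw [spinorSupport, ← QuadraticAlgebra.algebraMap_re (a := (1 : ℝ)) (b := 0)
    (16 * rootBB ε B z / h z), ← this]
  simp only [QuadraticAlgebra.re_mul (2 : PC), QuadraticAlgebra.re_ofNat, QuadraticAlgebra.im_ofNat,
    mul_zero, zero_mul, add_zero]

section Regular

variable (S : IsMinimalSpinor D ψ₁ ψ₂ h B ε) (h0 : ∀ z ∈ D, B z * star (B z) ≠ 0)

include S h0

lemma rootBB_pos (hz : z ∈ D) : 0 < rootBB ε B z :=
  NilT.rootBB_pos (h0 z hz) (S.sign z hz) (S.square z hz)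

lemma smoothOn_dualSpinor₁ : SmoothOn (dualSpinor₁ ε B h ψ₂) D := by
  rw [dualSpinor₁_eq]
  exact (SmoothOn.const 4).mul ((S.smoothOn_root h0).mul
    (S.smoothOn_invC.mul S.smooth₂.star.star))

lemma smoothOn_dualSpinor₂ : SmoothOn (dualSpinor₂ ε B h ψ₁) D := by
  rw [dualSpinor₂_eq]
  exact (SmoothOn.const 4).mul ((S.smoothOn_root h0).star.mul
    (S.smoothOn_invC.mul S.smooth₁))

/-- The Dirac equation of the dual spinors. -/
theorem dirac_dual {w : ℝ × ℝ → ℝ} (hw : ∀ z ∈ D, Real.exp (w z / 2) = 4 * rootBB ε B z / h z) :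
    IsDiracPotentialOn D ε (fun z => -(Real.exp (w z / 2) • ip))
      (dualSpinor₁ ε B h ψ₂) (dualSpinor₂ ε B h ψ₁) := by
  intro z hz
  have dr := (S.smoothOn_root h0).diffAt S.isOpen hz
  have dJ := S.smoothOn_invC.diffAt S.isOpen hz
  have d1 := S.smooth₁.diffAt S.isOpen hz
  have d2 := S.smooth₂.star.diffAt S.isOpen hz
  have hr0 := S.dzbar_root h0 hz
  obtain ⟨e1, e2⟩ := dzbar_inv_mul_star d1 d2 dJ (S.dirac z hz)
    (Filter.eventually_of_mem (S.isOpen.mem_nhds hz) fun _ hp => S.invC_mul hp) (S.coeff z)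
  -- As h is real, this is the conjugate of `e1`.
  have e3 : dz (fun p => invC h p * ψ₁ p) z
      = 4 * ip * (ψ₂ z * B z * (invC h z * invC h z)) := by
    have h4 : star (4 : PC) = 4 := by ext <;> simp
    have : (fun p => invC h p * ψ₁ p) = fun p => star (invC h p * star (ψ₁ p)) := by
      funext p
      rw [star_mul', star_star, star_invC]
    rw [this, dz_star, e1]
    simp only [star_neg, star_mul', star_star, star_invC, star_ip, h4]
    ring
  -- Written as 4 r r̄/h with r the root, the potential reduces the two Dirac equations to r² = εB
  -- and its conjugate.
  have hexp : algebraMap ℝ PC (4 * rootBB ε B z / h z)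
      = 4 * (psqrt (ε z * B z) * star (psqrt (ε z * B z))) * invC h z := by
    rw [S.root_mul_star hz, div_eq_mul_inv, map_mul, map_mul, invC]
    rfl
  have hr := psqrt_mul_self (S.square z hz)
  have hrs := congrArg star hr
  rw [star_mul', star_mul'] at hrs
  have he := (S.sign z hz).mul_self
  simp only [Algebra.smul_def, hw z hz, hexp]
  rw [dualSpinor₁_eq, dualSpinor₂_eq]
  rw [dz_const_mul _ (dr.star.mul (dJ.mul d1)), dz_mul dr.star (dJ.mul d1), dz_star, hr0, e3,
    dzbar_const_mul _ (dr.mul (dJ.mul d2.star)), dzbar_mul dr (dJ.mul d2.star), hr0, e2]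
  simp only [star_zero, star_star]
  generalize psqrt (ε z * B z) = r at *
  constructor
  · linear_combination -16 * star r * ip * invC h z * invC h z * ψ₂ z * hr
  · linear_combination -16 * r * ip * invC h z * invC h z * ψ₁ z * hrs

/-- The Abresch-Rosenberg coefficient of the dual surface. -/
theorem arCoeff_dual (hz : z ∈ D) :
    arCoeff 0 ε (dualSpinor₁ ε B h ψ₂) (dualSpinor₂ ε B h ψ₁) z = B z := by
  have dr := (S.smoothOn_root h0).diffAt S.isOpen hz
  have dJ := S.smoothOn_invC.diffAt S.isOpen hz
  have h1 := two_mul_arCoeff ε (dualSpinor₁ ε B h ψ₂) (dualSpinor₂ ε B h ψ₁) z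
  have e1 : dualSpinor₁ ε B h ψ₂ = fun p =>
      4 * (psqrt (ε p * B p) * invC h p) * star (star (ψ₂ p)) := by
    rw [dualSpinor₁_eq]
    funext p
    ring
  have e2 : (fun p => star (dualSpinor₂ ε B h ψ₁ p)) = fun p =>
      4 * (psqrt (ε p * B p) * invC h p) * star (ψ₁ p) := by
    funext p
    rw [star_dualSpinor₂]
    ring
  -- Here the common factor is c = 4r/h with c²h² = 16εB. The dual wronskian is therefore -2i'εB,
  -- and multiplication by -i'ε/2 returns B.
  have h2 := wronskian_dual (c := fun p => 4 * (psqrt (ε p * B p) * invC h p))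
    (S.smooth₁.diffAt S.isOpen hz) (S.smooth₂.star.diffAt S.isOpen hz)
    ((DiffAt.const 4).mul (dr.mul dJ)) (S.dirac z hz)
  have hw : wronskian (dualSpinor₁ ε B h ψ₂) (fun p => star (dualSpinor₂ ε B h ψ₁ p)) z
      = wronskian (fun p => 4 * (psqrt (ε p * B p) * invC h p) * star (star (ψ₂ p)))
        (fun p => 4 * (psqrt (ε p * B p) * invC h p) * star (ψ₁ p)) z := by
    rw [e2, e1]
  rw [← hw] at h2
  have h3 := S.invC_mul hz
  have hr := psqrt_mul_self (S.square z hz)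
  have he := (S.sign z hz).mul_self
  have i2 := ip_mul_ip
  generalize wronskian _ _ z = w at h1 h2
  generalize arCoeff 0 ε _ _ z = Bd at *
  generalize psqrt (ε z * B z) = r at *
  generalize supp _ _ z = H at *
  generalize invC h z = j at *
  have h4 : (j * H) ^ 2 = 1 := by rw [h3, one_pow]
  refine mul_left_cancel_ofNat (n := 16) ?_
  linear_combination 8 * h1 - ip * ε z * h2 + 16 * ε z * r * r * (j * H) ^ 2 * i2
    + 16 * ε z * r * r * h4 + 16 * ε z * hr + 16 * B z * he

/-- The dual of the dual. -/
theorem dual_dual (hz : z ∈ D) {Bd : ℝ × ℝ → PC} (hBd : Bd z = B z) {hd : ℝ × ℝ → ℝ}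
    (hhd : hd z = 16 * rootBB ε B z / h z) :
    dualSpinor₁ ε Bd hd (dualSpinor₂ ε B h ψ₁) z = ψ₁ z ∧
      dualSpinor₂ ε Bd hd (dualSpinor₁ ε B h ψ₂) z = ψ₂ z := by
  have hρ := S.rootBB_pos h0 hz
  have hh := S.pos z hz
  -- The two successive dual factors are 4r/h* and 4r̄/h, or their conjugates; their product is 16 r
  -- r̄/(h h*), which is 1 by the choice of h*.
  have e : invC hd z * (16 * (psqrt (ε z * B z) * star (psqrt (ε z * B z))) * invC h z) = 1 := by
    have h1 : algebraMap ℝ PC (hd z)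
        = 16 * (psqrt (ε z * B z) * star (psqrt (ε z * B z))) * invC h z := by
      rw [S.root_mul_star hz, hhd, div_eq_mul_inv, map_mul, map_mul, invC]
      rfl
    rw [← h1, invC, ← map_mul, inv_mul_cancel₀, map_one]
    rw [hhd]
    positivity
  rw [dualSpinor₁_eq, dualSpinor₂_eq, dualSpinor₂_eq, dualSpinor₁_eq]
  simp only [hBd, star_star]
  constructor
  · linear_combination ψ₁ z * e
  · linear_combination ψ₂ z * e

end Regular

end IsMinimalSpinor

/-! ### From spinor identities to the geometry of the dual surface -/

section Surface

variable {D : Set (ℝ × ℝ)} {f g N : ℝ × ℝ → Vec3} {u : ℝ × ℝ → ℝ} {σ : PC}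
  {ψ₁ ψ₂ B ε : ℝ × ℝ → PC} {h : ℝ × ℝ → ℝ} {z : ℝ × ℝ}

lemma IsConformalTimelikeOn.forms (hf : IsConformalTimelikeOn D 1 f u) (hz : z ∈ D) :
    formE f z = Real.exp (u z) ∧ formF f z = 0 ∧ formG f z = -formE f z := by
  have hE := hf.metricE z hz
  have hG := hf.metricG z hz
  simp only [Pi.one_apply, star_one, mul_one, QuadraticAlgebra.re_one, one_mul] at hE hG
  exact ⟨hE, hf.metricF z hz, by rw [hG, hE]⟩

lemma phi_eq_spinForm (hψ : IsGeneratedOn D 1 σ ψ₁ ψ₂ f) (hz : z ∈ D) (k : Fin 3) :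
    phi f k z = spinForm σ ψ₁ (fun p => star (ψ₂ p)) k z := by
  obtain ⟨h0, h1, h2⟩ := hψ z hz
  simp only [Pi.one_apply, one_mul, pow_two] at h0 h1 h2
  fin_cases k
  · exact h0
  · exact h1
  · exact h2

/-- The generating spinors of a minimal surface satisfy the Dirac equation. -/
theorem isMinimalSpinor_of_surface (hD : IsOpen D) (hf : IsConformalTimelikeOn D 1 f u)
    (hN : IsUnitNormalOn D f N) (hmin : ∀ z ∈ D, meanCurvature f N z = 0)
    (hσ : σ = ip ∨ σ = -ip) (hψ₁ : SmoothOn ψ₁ D) (hψ₂ : SmoothOn ψ₂ D)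
    (hψ : IsGeneratedOn D 1 σ ψ₁ ψ₂ f) (hh : h = spinorSupport ψ₁ ψ₂) (hpos : ∀ z ∈ D, 0 < h z)
    (hB : B = arCoeff 0 1 ψ₁ ψ₂) (hε : ∀ z ∈ D, IsSignUnit (ε z) ∧ IsSquare (ε z * B z)) :
    IsMinimalSpinor D ψ₁ ψ₂ h B ε := by
  have hsupp : ∀ z, supp ψ₁ (fun p => star (ψ₂ p)) z = algebraMap ℝ PC (h z) := by
    intro z
    have h2 : (2 : PC) = algebraMap ℝ PC 2 := rfl
    have h3 := mul_star_eq_algebraMap (ψ₂ z)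
    have h4 := mul_star_eq_algebraMap (ψ₁ z)
    rw [supp, hh, spinorSupport, map_mul, QuadraticAlgebra.re_sub, map_sub, ← h3, ← h4, h2,
      star_star, mul_comm (star (ψ₂ z))]
  refine ⟨hD, hψ₁, hψ₂, fun z hz => ?_, hsupp, hpos, fun z => ?_, fun z hz => (hε z hz).1,
    fun z hz => (hε z hz).2⟩
  · obtain ⟨hE, -, -⟩ := hf.forms hz
    have ht := tension_eq_zero hD hf.smooth (fun p hp => by rw [(hf.forms hp).2.2]; ring)
      hf.metricF (by rw [hE]; positivity) hN (hmin z hz) hz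
    refine diracEq_of_harmonicEq hσ (hψ₁.diffAt hD hz) (hψ₂.star.diffAt hD hz)
      (j := algebraMap ℝ PC (h z)⁻¹) ?_ (HarmonicEq.congr hD hz
        (fun p hp k => (phi_eq_spinForm hψ hp k).symm)
        ((harmonicEq_phi_iff hD hf.smooth hz).2 ht))
    rw [hsupp, ← map_mul, inv_mul_cancel₀ (hpos z hz).ne', map_one]
  · rw [hB, two_mul_arCoeff, Pi.one_apply, one_mul]

/-- The conformal factor of the dual surface. -/
lemma re_dual_factor (S : IsMinimalSpinor D ψ₁ ψ₂ h B ε) (hz : z ∈ D) :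
    (16 * (B z * (invC h z * invC h z)) * star (16 * (B z * (invC h z * invC h z)))).re
      = (ε z * star (ε z)).re * (16 * rootBB ε B z / h z ^ 2) ^ 2 := by
  have hh := (S.pos z hz).ne'
  obtain ⟨h1, h2⟩ := nonneg_of_isSquare (S.square z hz)
  have h3 : rootBB ε B z ^ 2 = (ε z * B z * star (ε z * B z)).re := by
    rw [rootBB_eq, Real.sq_sqrt]
    rw [re_mul_star, sq_sub_sq]
    exact mul_nonneg h1 h2
  have he := (S.sign z hz).mul_self
  have hes := congrArg star he
  rw [star_mul', star_one] at hes
  have h4 : (B z * star (B z)).re = (ε z * star (ε z)).re * rootBB ε B z ^ 2 := by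
    have e : B z * star (B z) = (ε z * star (ε z)) * (ε z * B z * star (ε z * B z)) := by
      rw [star_mul']
      linear_combination -B z * star (B z) * he - B z * star (B z) * ε z * ε z * hes
    have e2 : ∀ x y : PC, ((x * star x) * y).re = (x * star x).re * y.re := by
      intro x y
      rw [mul_star_eq_algebraMap x]
      simp
    rw [h3, ← e2, ← e]
  have h5 : 16 * (B z * (invC h z * invC h z)) * star (16 * (B z * (invC h z * invC h z)))
      = algebraMap ℝ PC (256 * (h z)⁻¹ ^ 4) * (B z * star (B z)) := by
    have h16 : star (16 : PC) = 16 := by ext <;> simp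
    have h256 : (256 : PC) = algebraMap ℝ PC 256 := rfl
    rw [map_mul, map_pow, ← h256]
    change _ = 256 * invC h z ^ 4 * _
    simp only [star_mul', h16, IsMinimalSpinor.star_invC]
    ring
  have h6 : ∀ (r : ℝ) (y : PC), (algebraMap ℝ PC r * y).re = r * y.re := by
    intro r y
    simp
  rw [h5, h6, h4]
  field_simp
  ring

/-- This places the pair of surfaces in the setting of conjugate derivatives with c = 16B/h², where
metric and normals can be compared without mentioning spinors. -/
lemma phi_dual (S : IsMinimalSpinor D ψ₁ ψ₂ h B ε) (hσ : σ = ip ∨ σ = -ip)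
    (hψ : IsGeneratedOn D 1 σ ψ₁ ψ₂ f) {W : Set (ℝ × ℝ)} (hW : W ⊆ D)
    (hg : IsGeneratedOn W ε (-σ) (dualSpinor₁ ε B h ψ₂) (dualSpinor₂ ε B h ψ₁) g)
    (hz : z ∈ W) (k : Fin 3) :
    phi g k z = 16 * (B z * (invC h z * invC h z)) * star (phi f k z) := by
  rw [(S.isGeneratedOn_iff hσ hW).1 hg z hz, phi_eq_spinForm hψ (hW hz)]
  rfl

section Regular

variable (S : IsMinimalSpinor D ψ₁ ψ₂ h B ε) (h0 : ∀ z ∈ D, B z * star (B z) ≠ 0)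
  (hσ : σ = ip ∨ σ = -ip) (hf : IsConformalTimelikeOn D 1 f u) (hN : IsUnitNormalOn D f N)
  (hψ : IsGeneratedOn D 1 σ ψ₁ ψ₂ f)
  (hg : IsGeneratedOn D ε (-σ) (dualSpinor₁ ε B h ψ₂) (dualSpinor₂ ε B h ψ₁) g)

include S h0 in
lemma re_dual_factor_ne_zero (hz : z ∈ D) :
    (16 * (B z * (invC h z * invC h z)) * star (16 * (B z * (invC h z * invC h z)))).re ≠ 0 := by
  have hρ := S.rootBB_pos h0 hz
  have hh := S.pos z hz
  rw [re_dual_factor S hz]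
  refine mul_ne_zero (re_mul_star_ne_zero fun h1 => h0 z hz ?_) (by positivity)
  have he := (S.sign z hz).mul_self
  have hes := congrArg star he
  rw [star_mul', star_one] at hes
  linear_combination ε z * star (ε z) * B z * star (B z) * h1 - B z * star (B z) * he
    - B z * star (B z) * ε z * ε z * hes

include S h0 hσ hf hN hψ hg in
/-- The unit normals of the dual surface are those of the original surface. -/
theorem normal_dual {N' : ℝ × ℝ → Vec3} (hN' : IsUnitNormalOn D g N') (hz : z ∈ D) :
    leftNormal g N' z = leftNormal f N z ∨ leftNormal g N' z = -leftNormal f N z := by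
  obtain ⟨hE, hF, hG⟩ := hf.forms hz
  obtain ⟨n1, n2, n3⟩ := hN z hz
  obtain ⟨m1, m2, m3⟩ := hN' z hz
  obtain ⟨m4, m5⟩ := normal_of_phi_conj (phi_dual S hσ hψ subset_rfl hg hz)
    (re_dual_factor_ne_zero S h0 hz) m2 m3
  refine normal_eq_or_eq_neg (e := formE f z) ?_ rfl hF hG n1 n2 n3 m1 m4 m5
  rw [hE]
  positivity

include S h0 hσ hf hN hψ hg in
/-- The geometry of the dual surface. -/
theorem geometry_dual (hgs : ContDiffOn ℝ ∞ g D) {s : ℝ}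
    (hsupp : ∀ z ∈ D, supportFn u f N z = s * h z) :
    ∃ (Nd : ℝ × ℝ → Vec3) (ud : ℝ × ℝ → ℝ), IsUnitNormalOn D g Nd ∧
      (∀ z ∈ D, leftNormal g Nd z = leftNormal f N z) ∧
      IsConformalTimelikeOn D ε g ud ∧
      (∀ z ∈ D, Real.exp (ud z / 2) = 16 * rootBB ε B z / h z ^ 2 * Real.exp (u z / 2)) ∧
      (∀ z ∈ D, supportFn ud g Nd z = s * (16 * rootBB ε B z / h z)) ∧
      (∀ z ∈ D, gaussMap g Nd z = gaussMap f N z) ∧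
      (∀ z ∈ D, meanCurvature g Nd z = 0) := by
  let Nd : ℝ × ℝ → Vec3 := fun z => leftPush (g z) (leftNormal f N z)
  -- The logarithm makes e^{ud/2} the required factor, which is positive because √(εε̄BB̄) and h
  -- are.
  let ud : ℝ × ℝ → ℝ := fun z =>
    2 * Real.log (16 * rootBB ε B z / h z ^ 2 * Real.exp (u z / 2))
  have hNd : ∀ z, leftNormal g Nd z = leftNormal f N z := fun z => leftPull_leftPush _ _
  have hud : ∀ z ∈ D, Real.exp (ud z / 2)
      = 16 * rootBB ε B z / h z ^ 2 * Real.exp (u z / 2) := by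
    intro z hz
    have hρ := S.rootBB_pos h0 hz
    have hh := S.pos z hz
    rw [mul_div_cancel_left₀ _ two_ne_zero, Real.exp_log (by positivity)]
  have hphi := fun z hz => phi_dual S hσ hψ subset_rfl hg (z := z) hz
  have hforms : ∀ z ∈ D, formE g z = (ε z * star (ε z)).re * Real.exp (ud z) ∧ formF g z = 0 ∧
      formG g z = -((ε z * star (ε z)).re * Real.exp (ud z)) := by
    intro z hz
    obtain ⟨hE, hF, hG⟩ := hf.forms hz
    obtain ⟨e1, e2, e3⟩ := forms_of_phi (hphi z hz) hF hG
    have e4 : (16 * (B z * (invC h z * invC h z)) *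
        star (16 * (B z * (invC h z * invC h z)))).re * formE f z
        = (ε z * star (ε z)).re * Real.exp (ud z) := by
      rw [re_dual_factor S hz, hE]
      have h1 : Real.exp (ud z) = Real.exp (ud z / 2) ^ 2 := by
        rw [← Real.exp_nat_mul]
        congr 1
        push_cast
        ring
      have h2 : Real.exp (u z) = Real.exp (u z / 2) ^ 2 := by
        rw [← Real.exp_nat_mul]
        congr 1
        push_cast
        ring
      rw [h1, h2, hud z hz]
      ring
    exact ⟨e1.trans e4, e2, e3.trans (by rw [e4])⟩
  have hE0 : ∀ z ∈ D, formE g z ≠ 0 := by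
    intro z hz
    obtain ⟨hE, hF, hG⟩ := hf.forms hz
    rw [(forms_of_phi (hphi z hz) hF hG).1, hE]
    exact mul_ne_zero (re_dual_factor_ne_zero S h0 hz) (by positivity)
  refine ⟨Nd, ud, fun z hz => ?_, fun z _ => hNd z, ⟨hgs, fun z hz => ?_,
    fun z hz => (hforms z hz).1, fun z hz => (hforms z hz).2.1, fun z hz => (hforms z hz).2.2⟩,
    hud, fun z hz => ?_, fun z hz => ?_, fun z hz => ?_⟩
  · rw [hNd]
    obtain ⟨n1, n2, n3⟩ := hN z hz
    exact ⟨n1, normal_of_phi (hphi z hz) n2 n3⟩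
  · refine injective_fderiv_of_forms (hE0 z hz) (hforms z hz).2.1 ?_
    rw [(hforms z hz).2.2, ← (hforms z hz).1]
    exact neg_ne_zero.2 (hE0 z hz)
  · have h1 := hsupp z hz
    have hh := (S.pos z hz).ne'
    have h2 : ∀ (t : ℝ) (n : Vec3), lip (t • n) ![0, 0, 1] = t * n 2 := by
      intro t n
      simp [lip]
    rw [supportFn, h2] at h1 ⊢
    rw [hNd, hud z hz, mul_assoc, h1]
    field_simp
  · rw [gaussMap, gaussMap, hNd]
  · refine meanCurvature_eq_zero ?_ (hforms z hz).2.1 ?_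
    · rw [(hforms z hz).1, (hforms z hz).2.2]
      ring
    · exact (harmonicEq_phi_iff S.isOpen hgs hz).1 (HarmonicEq.congr S.isOpen hz
        ((S.isGeneratedOn_iff hσ subset_rfl).1 hg) (S.harmonicEq_dual hσ hz))

include S hσ hN hψ hg in
-- The support function of f is a nonzero multiple of the ε₃-component of its normal. This component
-- is nonzero since h > 0, and the same vector is normal to the dual surface.
theorem isNonverticalAt_dual {s : ℝ} (hs : s = 1 ∨ s = -1)
    (hsupp : ∀ z ∈ D, supportFn u f N z = s * h z) (hz : z ∈ D) : IsNonverticalAt g z := by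
  obtain ⟨-, n2, n3⟩ := hN z hz
  obtain ⟨m2, m3⟩ := normal_of_phi (phi_dual S hσ hψ subset_rfl hg hz) n2 n3
  refine isNonverticalAt_of_normal m2 m3 fun h1 => ?_
  have h2 := hsupp z hz
  have h3 : s * h z = 0 := by
    rw [← h2]
    simp [supportFn, lip, h1]
  have hh := (S.pos z hz).ne'
  rcases hs with rfl | rfl <;> simp [hh] at h3

end Regular

end Surface

end NilT

end

/-! ### The duality theorem -/

theorem mainTheorem4
    (D : Set (ℝ × ℝ)) (hDopen : IsOpen D) (hDsc : SimplyConnectedSpace D)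
    (f N : ℝ × ℝ → NilT.Vec3) (u : ℝ × ℝ → ℝ)
    (hf : NilT.IsConformalTimelikeOn D 1 f u)
    (hN : NilT.IsUnitNormalOn D f N)
    (hmin : ∀ z ∈ D, NilT.meanCurvature f N z = 0)
    (σ : NilT.PC) (hσ : σ = NilT.ip ∨ σ = -NilT.ip)
    (ψ₁ ψ₂ : ℝ × ℝ → NilT.PC) (hψ₁ : NilT.SmoothOn ψ₁ D) (hψ₂ : NilT.SmoothOn ψ₂ D)
    (hψ : NilT.IsGeneratedOn D 1 σ ψ₁ ψ₂ f)
    -- the support function, up to the sign `s` that depends on the orientation of `N`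
    (h : ℝ × ℝ → ℝ) (hh : h = NilT.spinorSupport ψ₁ ψ₂) (hpos : ∀ z ∈ D, 0 < h z)
    (s : ℝ) (hs : s = 1 ∨ s = -1) (hsupp : ∀ z ∈ D, NilT.supportFn u f N z = s * h z)
    -- the Abresch-Rosenberg coefficient; `f` is not a null scroll
    (B : ℝ × ℝ → NilT.PC) (hB : B = NilT.arCoeff 0 1 ψ₁ ψ₂)
    (hnull : ∃ z ∈ D, B z * star (B z) ≠ 0)
    (ε : ℝ × ℝ → NilT.PC)
    (hε : ∀ z ∈ D, NilT.IsSignUnit (ε z) ∧ IsSquare (ε z * B z)) :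
    let R : Set (ℝ × ℝ) := {z | z ∈ D ∧ B z * star (B z) ≠ 0}
    let ψd₁ : ℝ × ℝ → NilT.PC := NilT.dualSpinor₁ ε B h ψ₂
    let ψd₂ : ℝ × ℝ → NilT.PC := NilT.dualSpinor₂ ε B h ψ₁
    let hd : ℝ × ℝ → ℝ := fun z => 16 * NilT.rootBB ε B z / h z
    let Bd : ℝ × ℝ → NilT.PC := NilT.arCoeff 0 ε ψd₁ ψd₂
    -- existence of the dual surface
    (∃ fd : ℝ × ℝ → NilT.Vec3, NilT.IsDualSurfaceOn D 1 ε σ ψ₁ ψ₂ B h fd) ∧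
    -- smoothness of the dual spinors and their Dirac potential
    NilT.SmoothOn ψd₁ R ∧ NilT.SmoothOn ψd₂ R ∧
    (∃ w : ℝ × ℝ → ℝ,
      (∀ z ∈ R, Real.exp (w z / 2) = 4 * NilT.rootBB ε B z / h z) ∧
      NilT.IsDiracPotentialOn R ε (fun z => -(Real.exp (w z / 2) • NilT.ip)) ψd₁ ψd₂ ∧
      NilT.IsDiracPotentialOn R ε (fun z => Real.exp (w z / 2) • NilT.ip)
        (fun z => NilT.ip * ψd₁ z) (fun z => -(NilT.ip * ψd₂ z))) ∧
    (∀ z ∈ R, NilT.spinorSupport (fun z => NilT.ip * ψd₁ z) (fun z => -(NilT.ip * ψd₂ z)) z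
      = hd z) ∧
    -- the Abresch-Rosenberg coefficient is preserved
    (∀ z ∈ R, Bd z = B z) ∧
    -- properties of every dual surface
    (∀ fd : ℝ × ℝ → NilT.Vec3, NilT.IsDualSurfaceOn D 1 ε σ ψ₁ ψ₂ B h fd →
      NilT.IsGeneratedOn R ε (-σ) ψd₁ ψd₂ fd ∧
      NilT.IsGeneratedOn R ε (-σ)
        (fun z => NilT.ip * ψd₁ z) (fun z => -(NilT.ip * ψd₂ z)) fd ∧
      (∀ N' : ℝ × ℝ → NilT.Vec3, NilT.IsUnitNormalOn R fd N' → ∀ z ∈ R,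
        NilT.leftNormal fd N' z = NilT.leftNormal f N z ∨
        NilT.leftNormal fd N' z = -NilT.leftNormal f N z) ∧
      (∃ (Nd : ℝ × ℝ → NilT.Vec3) (ud : ℝ × ℝ → ℝ),
        NilT.IsUnitNormalOn R fd Nd ∧
        (∀ z ∈ R, NilT.leftNormal fd Nd z = NilT.leftNormal f N z) ∧
        NilT.IsConformalTimelikeOn R ε fd ud ∧
        (∀ z ∈ R, Real.exp (ud z / 2)
          = 16 * NilT.rootBB ε B z / h z ^ 2 * Real.exp (u z / 2)) ∧
        (∀ z ∈ R, NilT.supportFn ud fd Nd z = s * hd z) ∧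
        (∀ z ∈ R, NilT.gaussMap fd Nd z = NilT.gaussMap f N z) ∧
        (∀ z ∈ R, NilT.meanCurvature fd Nd z = 0)) ∧
      (∀ z ∈ R, NilT.IsNonverticalAt fd z)) ∧
    -- duality
    (∀ z ∈ R, NilT.dualSpinor₁ ε Bd hd ψd₂ z = ψ₁ z ∧ NilT.dualSpinor₂ ε Bd hd ψd₁ z = ψ₂ z) ∧
    NilT.IsDualSurfaceOn R ε ε (-σ) ψd₁ ψd₂ Bd hd f ∧
    (∀ W : Set (ℝ × ℝ), IsOpen W → IsPreconnected W → W ⊆ R →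
      ∀ fdd : ℝ × ℝ → NilT.Vec3, NilT.IsDualSurfaceOn W ε ε (-σ) ψd₁ ψd₂ Bd hd fdd →
        ∃ p : NilT.Vec3, ∀ z ∈ W, fdd z = NilT.nilMul p (f z)) := by

  intro R ψd₁ ψd₂ hd Bd
  have S := NilT.isMinimalSpinor_of_surface hDopen hf hN hmin hσ hψ₁ hψ₂ hψ hh hpos hB hε
  have SR : NilT.IsMinimalSpinor R ψ₁ ψ₂ h B ε := S.regular
  have hRD : R ⊆ D := fun z hz => hz.1
  have h0 : ∀ z ∈ R, B z * star (B z) ≠ 0 := fun z hz => hz.2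
  have hκ : (fun z => ε z * (1 : ℝ × ℝ → NilT.PC) z) = ε := by
    funext z
    rw [Pi.one_apply, mul_one]
  have hfR : NilT.IsConformalTimelikeOn R 1 f u :=
    ⟨hf.smooth.mono hRD, fun z hz => hf.immersion z hz.1, fun z hz => hf.metricE z hz.1,
      fun z hz => hf.metricF z hz.1, fun z hz => hf.metricG z hz.1⟩
  have hNR : NilT.IsUnitNormalOn R f N := fun z hz => hN z hz.1
  have hψR : NilT.IsGeneratedOn R 1 σ ψ₁ ψ₂ f := fun z hz => hψ z hz.1
  have hsR : ∀ z ∈ R, NilT.supportFn u f N z = s * h z := fun z hz => hsupp z hz.1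
  have hBd : ∀ z ∈ R, Bd z = B z := fun z hz => SR.arCoeff_dual h0 hz
  have hdd : ∀ z ∈ R, NilT.dualSpinor₁ ε Bd hd ψd₂ z = ψ₁ z ∧
      NilT.dualSpinor₂ ε Bd hd ψd₁ z = ψ₂ z := fun z hz => SR.dual_dual h0 hz (hBd z hz) rfl
  -- Dualizing twice restores the data of f: ε² = 1 returns the coordinate z, the sign changes back,
  -- and the spinors return by `hdd`. A dual surface of f* is therefore the same as a map generated
  -- by ψ₁, ψ₂.
  have hgen : ∀ W ⊆ R, ∀ g : ℝ × ℝ → NilT.Vec3,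
      NilT.IsGeneratedOn W (fun z => ε z * ε z) (-(-σ)) (NilT.dualSpinor₁ ε Bd hd ψd₂)
        (NilT.dualSpinor₂ ε Bd hd ψd₁) g ↔ NilT.IsGeneratedOn W 1 σ ψ₁ ψ₂ g := by
    intro W hW g
    refine forall₂_congr fun z hz => ?_
    rw [(hdd z (hW hz)).1, (hdd z (hW hz)).2]
    simp only [(SR.sign z (hW hz)).mul_self, neg_neg, Pi.one_apply]
  refine ⟨?_, SR.smoothOn_dualSpinor₁ h0, SR.smoothOn_dualSpinor₂ h0, ?_,
    fun z hz => SR.spinorSupport_dual hz, hBd, ?_, hdd, ?_, ?_⟩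
  · obtain ⟨fd, h1, h2⟩ := S.exists_dual hσ hDsc
    exact ⟨fd, h1, by rw [hκ]; exact h2⟩
  · have hw : ∀ z ∈ R, Real.exp (2 * Real.log (4 * NilT.rootBB ε B z / h z) / 2)
        = 4 * NilT.rootBB ε B z / h z := by
      intro z hz
      have hρ := SR.rootBB_pos h0 hz
      have hh := SR.pos z hz
      rw [mul_div_cancel_left₀ _ two_ne_zero, Real.exp_log (by positivity)]
    have hdirac := SR.dirac_dual h0 (w := fun z => 2 * Real.log (4 * NilT.rootBB ε B z / h z)) hw
    exact ⟨_, hw, hdirac, NilT.isDiracPotentialOn_ip_mul SR.isOpen (SR.smoothOn_dualSpinor₁ h0)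
      (SR.smoothOn_dualSpinor₂ h0) hdirac⟩
  · rintro fd ⟨h1, h2⟩
    rw [hκ] at h2
    have h3 : NilT.IsGeneratedOn R ε (-σ) ψd₁ ψd₂ fd := fun z hz => h2 z hz.1
    exact ⟨h3, NilT.isGeneratedOn_ip_mul h3,
      fun N' hN' z hz => NilT.normal_dual SR h0 hσ hfR hNR hψR h3 hN' hz,
      NilT.geometry_dual SR h0 hσ hfR hNR hψR h3 (h1.mono hRD) hsR,
      fun z hz => NilT.isNonverticalAt_dual SR hσ hNR hψR h3 hs hsR hz⟩
  · exact ⟨hfR.smooth, (hgen R subset_rfl f).2 hψR⟩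
  · rintro W hWo hWc hWR fdd ⟨h1, h2⟩
    have h3 := (hgen W hWR fdd).1 h2
    have h4 : NilT.IsGeneratedOn W 1 σ ψ₁ ψ₂ f := fun z hz => hψR z (hWR hz)
    exact NilT.exists_eq_nilMul hWo hWc (hfR.smooth.mono hWR) h1 fun z hz k => by
      rw [NilT.phi_eq_spinForm h3 hz, NilT.phi_eq_spinForm h4 hz]
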